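/- Let $\alpha>-1$, $c>0$, $M\ge 0$, $N\ge 0$. Put $\langle f,g\rangle_\alpha=\int_0^\infty f(x)g(x)x^\alpha e^{-x}\,dx$ and $\langle f,g\rangle_S=\langle f,g\rangle_\alpha+Mf(c)g(c)+Nf'(c)g'(c)$ for real polynomials $f,g$. Let $(\widehat L_n)_{n\ge 0}$ and $(\widehat S_n)_{n\ge 0}$ be the sequences of monic orthogonal polynomials with respect to $\langle\cdot,\cdot\rangle_\alpha$ and $\langle\cdot,\cdot\rangle_S$ respectively ($\deg\widehat L_n=\deg\widehat S_n=n$), put $\widehat L_k=0$ for $k<0$, and let $\|f\|_\alpha^2=\langle f,f\rangle_\alpha$. Let $\beta_n=2n+\alpha+1$ and $\gamma_n=n(n+\alpha)$ be the coefficients of the Laguerre recurrence $x\widehat L_n=\widehat L_{n+1}+\beta_n\widehat L_n+\gamma_n\widehat L_{n-1}$, and for $n\ge 1$ put $$A_1(n;c)=-\frac{M\widehat S_n(c)\widehat L_{n-1}(c)+N\widehat S_n'(c)\widehat L_{n-1}'(c)}{\|\widehat L_{n-1}\|_\alpha^2},\qquad A_0(n;c)=-\frac{N\widehat S_n'(c)\widehat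 L_{n-1}(c)}{\|\widehat L_{n-1}\|_\alpha^2},$$ $$B_1(n;c)=\frac{M\widehat S_n(c)\widehat L_{n}(c)+N\widehat S_n'(c)\widehat L_{n}'(c)}{\|\widehat L_{n-1}\|_\alpha^2},\qquad B_0(n;c)=\frac{N\widehat S_n'(c)\widehat L_{n}(c)}{\|\widehat L_{n-1}\|_\alpha^2}.$$ Then for every $n\ge 1$ the connection formula $$(x-c)^2\widehat S_n(x)=\big[(x-c)^2+(x-c)A_1(n;c)+A_0(n;c)\big]\widehat L_n(x)+\big[(x-c)B_1(n;c)+B_0(n;c)\big]\widehat L_{n-1}(x)$$ holds, and it reads as $$(x-c)^2\widehat S_n(x)=\widehat L_{n+2}(x)+\tilde b_n\widehat L_{n+1}(x)+\tilde c_n\widehat L_n(x)+\tilde d_n\widehat L_{n-1}(x)+\tilde e_n\widehat L_{n-2}(x),$$ where $$\tilde b_n=\beta_{n+1}+\beta_n-2c+A_1(n;c),$$ $$\tilde c_n=\gamma_{n+1}+\gamma_n+(\beta_n-c)^2+A_1(n;c)(\beta_n-c)+A_0(n;c)+B_1(n;c),$$ $$\tilde d_n=\gamma_n(\beta_n+\beta_{n-1}-2c)+\gamma_nA_1(n;c)+(\beta_{n-1}-c)B_1(n;c)+B_0(n;c),$$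 $$\tilde e_n=\gamma_n\gamma_{n-1}+\gamma_{n-1}B_1(n;c).$$ Moreover, as $n\to\infty$, $$\frac{\tilde b_n}{4n}\to 1,\qquad \frac{\tilde c_n}{6n^2}\to 1,\qquad \frac{\tilde d_n}{4n^3}\to 1,\qquad \frac{\tilde e_n}{n^4}\to 1.$$ -/

import Mathlib

open Polynomial MeasureTheory Filter Topology

noncomputable section

namespace LaguerreSobolev

/-- A real inner product on the space of real polynomials: additive and homogeneous in the first
argument, symmetric, positive definite. -/
structure IsInnerProduct (B : ℝ[X] → ℝ[X] → ℝ) : Prop where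
  add_left : ∀ f g h, B (f + g) h = B f h + B g h
  smul_left : ∀ (a : ℝ) f g, B (C a * f) g = a * B f g
  symm : ∀ f g, B f g = B g f
  pos : ∀ f, f ≠ 0 → 0 < B f f

/-- `P` is a sequence of monic polynomials, `P n` of degree `n`, mutually orthogonal for `B`. -/
structure IsMonicOrthogonal (B : ℝ[X] → ℝ[X] → ℝ) (P : ℕ → ℝ[X]) : Prop where
  monic : ∀ n, (P n).Monic
  natDegree_eq : ∀ n, (P n).natDegree = n
  orthogonal : ∀ m n, m ≠ n → B (P m) (P n) = 0

/-- The monic orthogonal polynomials of the form `B`, obtained by the Gram-Schmidt process from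
the monomials. By `isMonicOrthogonal_iff` below this is the only sequence of monic orthogonal
polynomials when `B` is an inner product. -/
def monicOP (B : ℝ[X] → ℝ[X] → ℝ) : ℕ → ℝ[X]
  | n => X ^ n - ∑ k : Fin n,
      C (B (X ^ n) (monicOP B k) / B (monicOP B k) (monicOP B k)) * monicOP B k
termination_by n => n
decreasing_by exact k.2

/-- The inner product `∫₀^∞ f(x) g(x) x^α e^{-x} dx`. -/
def laguerreInner (α : ℝ) (f g : ℝ[X]) : ℝ :=
  ∫ x in Set.Ioi (0 : ℝ), f.eval x * g.eval x * x ^ α * Real.exp (-x)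

/-- The discrete Sobolev inner product
`∫₀^∞ f(x) g(x) x^α e^{-x} dx + M f(c) g(c) + N f'(c) g'(c)`. -/
def sobolevInner (α c M N : ℝ) (f g : ℝ[X]) : ℝ :=
  laguerreInner α f g + M * f.eval c * g.eval c
    + N * (derivative f).eval c * (derivative g).eval c

/-- The monic Laguerre polynomials, with the convention that they vanish at negative indices. -/
def laguerre (α : ℝ) : ℤ → ℝ[X]
  | Int.ofNat n => monicOP (laguerreInner α) n
  | Int.negSucc _ => 0

/-- The squared norm of the monic Laguerre polynomial of index `k`. -/
def laguerreNormSq (α : ℝ) (k : ℤ) : ℝ := laguerreInner α (laguerre α k) (laguerre α k)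

/-- The monic Laguerre-Sobolev type polynomials. -/
def sobolev (α c M N : ℝ) (n : ℕ) : ℝ[X] := monicOP (sobolevInner α c M N) n

/-- The coefficient `β_k = 2k + α + 1` of the three-term recurrence
`x L_k = L_{k+1} + β_k L_k + γ_k L_{k-1}` of the monic Laguerre polynomials. -/
def betaCoeff (α : ℝ) (k : ℤ) : ℝ := 2 * k + α + 1

/-- The coefficient `γ_k = k (k + α)` of the same recurrence. -/
def gammaCoeff (α : ℝ) (k : ℤ) : ℝ := k * (k + α)

/-- `A₁(n; c)`. -/
def coeffA1 (α c M N : ℝ) (n : ℕ) : ℝ :=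
  -(M * (sobolev α c M N n).eval c * (laguerre α (n - 1)).eval c / laguerreNormSq α (n - 1))
    - N * (derivative (sobolev α c M N n)).eval c * (derivative (laguerre α (n - 1))).eval c
        / laguerreNormSq α (n - 1)

/-- `A₀(n; c)`. -/
def coeffA0 (α c M N : ℝ) (n : ℕ) : ℝ :=
  -(N * (derivative (sobolev α c M N n)).eval c * (laguerre α (n - 1)).eval c
      / laguerreNormSq α (n - 1))

/-- `B₁(n; c)`. -/
def coeffB1 (α c M N : ℝ) (n : ℕ) : ℝ :=
  M * (sobolev α c M N n).eval c * (laguerre α n).eval c / laguerreNormSq α (n - 1)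
    + N * (derivative (sobolev α c M N n)).eval c * (derivative (laguerre α n)).eval c
        / laguerreNormSq α (n - 1)

/-- `B₀(n; c)`. -/
def coeffB0 (α c M N : ℝ) (n : ℕ) : ℝ :=
  N * (derivative (sobolev α c M N n)).eval c * (laguerre α n).eval c / laguerreNormSq α (n - 1)

/-- `A(n; x) = (x - c)² + (x - c) A₁(n; c) + A₀(n; c)`. -/
def polyA (α c M N : ℝ) (n : ℕ) : ℝ[X] :=
  (X - C c) ^ 2 + (X - C c) * C (coeffA1 α c M N n) + C (coeffA0 α c M N n)

/-- `B(n; x) = (x - c) B₁(n; c) + B₀(n; c)`. -/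
def polyB (α c M N : ℝ) (n : ℕ) : ℝ[X] :=
  (X - C c) * C (coeffB1 α c M N n) + C (coeffB0 α c M N n)

/-- The coefficient of `L_{n+1}`. -/
def bTilde (α c M N : ℝ) (n : ℕ) : ℝ :=
  betaCoeff α (n + 1) + betaCoeff α n - 2 * c + coeffA1 α c M N n

/-- The coefficient of `L_n`. -/
def cTilde (α c M N : ℝ) (n : ℕ) : ℝ :=
  gammaCoeff α (n + 1) + gammaCoeff α n + (betaCoeff α n - c) ^ 2
    + coeffA1 α c M N n * (betaCoeff α n - c) + coeffA0 α c M N n + coeffB1 α c M N n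

/-- The coefficient of `L_{n-1}`. -/
def dTilde (α c M N : ℝ) (n : ℕ) : ℝ :=
  gammaCoeff α n * (betaCoeff α n + betaCoeff α (n - 1) - 2 * c)
    + gammaCoeff α n * coeffA1 α c M N n
    + (betaCoeff α (n - 1) - c) * coeffB1 α c M N n + coeffB0 α c M N n

/-- The coefficient of `L_{n-2}`. -/
def eTilde (α c M N : ℝ) (n : ℕ) : ℝ :=
  gammaCoeff α n * gammaCoeff α (n - 1) + gammaCoeff α (n - 1) * coeffB1 α c M N n

/-! The two forms above are inner products, and the Gram-Schmidt sequences are therefore the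
monic orthogonal polynomials. -/

theorem IsInnerProduct.zero_left {B : ℝ[X] → ℝ[X] → ℝ} (hB : IsInnerProduct B) (f : ℝ[X]) :
    B 0 f = 0 := by
  have := hB.smul_left 0 0 f
  simpa using this

theorem IsInnerProduct.sub_left {B : ℝ[X] → ℝ[X] → ℝ} (hB : IsInnerProduct B) (f g h : ℝ[X]) :
    B (f - g) h = B f h - B g h := by
  have h1 : f - g = f + C (-1) * g := by simp [sub_eq_add_neg]
  rw [h1, hB.add_left, hB.smul_left]; ring

theorem IsInnerProduct.sum_left {B : ℝ[X] → ℝ[X] → ℝ} (hB : IsInnerProduct B) {ι : Type}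
    (s : Finset ι) (F : ι → ℝ[X]) (g : ℝ[X]) : B (∑ i ∈ s, F i) g = ∑ i ∈ s, B (F i) g := by
  classical
  induction s using Finset.induction_on with
  | empty => simpa using hB.zero_left g
  | insert a s ha ih => rw [Finset.sum_insert ha, Finset.sum_insert ha, hB.add_left, ih]

theorem monicOP_eq (B : ℝ[X] → ℝ[X] → ℝ) (n : ℕ) :
    monicOP B n = X ^ n - ∑ k : Fin n,
      C (B (X ^ n) (monicOP B k) / B (monicOP B k) (monicOP B k)) * monicOP B k := by
  rw [monicOP]

theorem monicOP_monic (B : ℝ[X] → ℝ[X] → ℝ) (n : ℕ) :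
    (monicOP B n).Monic ∧ (monicOP B n).natDegree = n := by
  induction n using Nat.strong_induction_on with
  | _ n ih =>
    have hlt : (-∑ k : Fin n, C (B (X ^ n) (monicOP B k) / B (monicOP B k) (monicOP B k))
        * monicOP B k).degree < (n : WithBot ℕ) := by
      rw [degree_neg]
      refine (degree_sum_le _ _).trans_lt ?_
      refine (Finset.sup_lt_iff (WithBot.bot_lt_coe n)).2 fun k _ => ?_
      rw [C_mul']
      refine (degree_smul_le _ _).trans_lt ?_
      rw [degree_eq_natDegree (ih k k.2).1.ne_zero, (ih k k.2).2]
      exact WithBot.coe_lt_coe.2 k.2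
    rw [monicOP_eq, sub_eq_add_neg]
    have hm := monic_X_pow_add hlt
    refine ⟨hm, ?_⟩
    have : (X ^ n + -∑ k : Fin n, C (B (X ^ n) (monicOP B k) / B (monicOP B k) (monicOP B k))
        * monicOP B k).degree = (n : WithBot ℕ) := by
      rw [degree_add_eq_left_of_degree_lt (by rwa [degree_X_pow]), degree_X_pow]
    exact natDegree_eq_of_degree_eq_some this

theorem monicOP_orthogonal {B : ℝ[X] → ℝ[X] → ℝ} (hB : IsInnerProduct B) (n : ℕ) :
    ∀ m < n, B (monicOP B n) (monicOP B m) = 0 := by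
  induction n using Nat.strong_induction_on with
  | _ n ih =>
    intro m hm
    have hpos := hB.pos _ (monicOP_monic B m).1.ne_zero
    rw [monicOP_eq B n, hB.sub_left, hB.sum_left,
      Finset.sum_eq_single (⟨m, hm⟩ : Fin n) _ (by simp)]
    · rw [hB.smul_left, div_mul_cancel₀ _ hpos.ne', sub_self]
    · intro k _ hk
      have hk' : (k : ℕ) ≠ m := fun h => hk (Fin.ext h)
      rw [hB.smul_left]
      rcases lt_or_gt_of_ne hk' with h | h
      · rw [hB.symm (monicOP B k) (monicOP B m), ih m hm k h, mul_zero]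
      · rw [ih k k.2 m h, mul_zero]

theorem IsMonicOrthogonal.eq_zero_of_degree_lt {B : ℝ[X] → ℝ[X] → ℝ} (hB : IsInnerProduct B)
    {P : ℕ → ℝ[X]} (hP : IsMonicOrthogonal B P) (n m : ℕ) (hmn : m ≤ n) (q : ℝ[X])
    (hq : q.degree < m) : B q (P n) = 0 := by
  induction m generalizing q with
  | zero =>
    have : q = 0 := by
      rw [← degree_eq_bot]
      simpa using hq
    rw [this, hB.zero_left]
  | succ m ih =>
    have h1 : q = (q - C (q.coeff m) * P m) + C (q.coeff m) * P m := by ring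
    have h2 : (q - C (q.coeff m) * P m).degree < (m : WithBot ℕ) := by
      rw [degree_lt_iff_coeff_zero]
      intro j hj
      rcases hj.eq_or_lt with rfl | hj
      · have := hP.monic m
        rw [Monic, leadingCoeff, hP.natDegree_eq] at this
        simp [this]
      · have e1 : q.coeff j = 0 := (degree_lt_iff_coeff_zero q (m + 1)).1 hq j hj
        have e2 : (P m).coeff j = 0 := coeff_eq_zero_of_natDegree_lt (by rwa [hP.natDegree_eq])
        simp [e1, e2]
    rw [h1, hB.add_left, hB.smul_left, ih (by omega) _ h2, hP.orthogonal m n (by omega)]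
    simp

/-- For an inner product, `monicOP` is the unique sequence of monic orthogonal polynomials. -/
theorem isMonicOrthogonal_iff {B : ℝ[X] → ℝ[X] → ℝ} (hB : IsInnerProduct B) (P : ℕ → ℝ[X]) :
    IsMonicOrthogonal B P ↔ P = monicOP B := by
  have key : IsMonicOrthogonal B (monicOP B) :=
    ⟨fun n => (monicOP_monic B n).1, fun n => (monicOP_monic B n).2, fun m n h => by
      rcases lt_or_gt_of_ne h with h | h
      · rw [hB.symm]; exact monicOP_orthogonal hB n m h
      · exact monicOP_orthogonal hB m n h⟩
  refine ⟨fun hP => funext fun n => ?_, fun h => h ▸ key⟩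
  by_contra hne
  have h0 : P n - monicOP B n ≠ 0 := sub_ne_zero.2 hne
  have hd : (P n - monicOP B n).degree < (n : WithBot ℕ) := by
    have h1 : (P n).degree = n := by
      rw [degree_eq_natDegree (hP.monic n).ne_zero, hP.natDegree_eq]
    have h2 : (monicOP B n).degree = n := by
      rw [degree_eq_natDegree (key.monic n).ne_zero, key.natDegree_eq]
    rw [← h1]
    exact degree_sub_lt_left (h1.trans h2.symm) (hP.monic n).ne_zero
      ((hP.monic n).leadingCoeff.trans (key.monic n).leadingCoeff.symm)
  have hp := hB.pos _ h0
  rw [hB.symm, hB.sub_left, hB.symm (P n), hB.symm (monicOP B n),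
    hP.eq_zero_of_degree_lt hB n n le_rfl _ hd, key.eq_zero_of_degree_lt hB n n le_rfl _ hd] at hp
  simp at hp

theorem laguerre_integrable {α : ℝ} (hα : -1 < α) (p : ℝ[X]) :
    IntegrableOn (fun x : ℝ => p.eval x * x ^ α * Real.exp (-x)) (Set.Ioi 0) := by
  induction p using Polynomial.induction_on' with
  | add p q hp hq =>
    refine (hp.add hq).congr_fun (fun x _ => ?_) measurableSet_Ioi
    simp only [Pi.add_apply, eval_add]; ring
  | monomial k a =>
    have h : IntegrableOn _ (Set.Ioi (0 : ℝ)) := (Real.GammaIntegral_convergent (s := k + α + 1)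
      (by have : (0 : ℝ) ≤ k := Nat.cast_nonneg k
          linarith)).const_mul a
    refine IntegrableOn.congr_fun h (fun x hx => ?_) measurableSet_Ioi
    have hx' : (0 : ℝ) < x := hx
    simp only [eval_monomial]
    rw [show (k : ℝ) + α + 1 - 1 = k + α by ring, Real.rpow_add hx', Real.rpow_natCast]
    ring

theorem isInnerProduct_laguerreInner {α : ℝ} (hα : -1 < α) :
    IsInnerProduct (laguerreInner α) where
  add_left f g h := by
    have h1 := laguerre_integrable hα (f * h)
    have h2 := laguerre_integrable hα (g * h)
    simp only [eval_mul] at h1 h2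
    unfold laguerreInner
    rw [← integral_add h1 h2]
    congr 1
    funext x
    simp only [eval_add]; ring
  smul_left a f g := by
    unfold laguerreInner
    rw [← integral_const_mul]
    congr 1
    funext x
    simp only [eval_mul, eval_C]; ring
  symm f g := by
    unfold laguerreInner
    congr 1
    funext x
    ring
  pos f hf := by
    have h1 := laguerre_integrable hα (f * f)
    simp only [eval_mul] at h1
    unfold laguerreInner
    rw [setIntegral_pos_iff_support_of_nonneg_ae _ h1]
    · have hsub : Set.Ioi (0 : ℝ) \ (f.roots.toFinset : Set ℝ) ⊆ Function.support
          (fun x : ℝ => f.eval x * f.eval x * x ^ α * Real.exp (-x)) ∩ Set.Ioi 0 := by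
        rintro x ⟨hx, hr⟩
        refine ⟨?_, hx⟩
        have hx' : (0 : ℝ) < x := hx
        have hfx : f.eval x ≠ 0 := by
          intro h0
          apply hr
          simp [hf, h0]
        have h3 : x ^ α ≠ 0 := (Real.rpow_pos_of_pos hx' α).ne'
        have h4 : Real.exp (-x) ≠ 0 := (Real.exp_pos _).ne'
        exact mul_ne_zero (mul_ne_zero (mul_ne_zero hfx hfx) h3) h4
      refine lt_of_lt_of_le ?_ (measure_mono hsub)
      rw [measure_sdiff_null (Set.Finite.measure_zero (Finset.finite_toSet _) _)]
      simp
    · refine (ae_restrict_iff' measurableSet_Ioi).2 (Eventually.of_forall fun x hx => ?_)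
      have hx' : (0 : ℝ) < x := hx
      have h3 := (Real.rpow_pos_of_pos hx' α).le
      exact mul_nonneg (mul_nonneg (mul_self_nonneg _) h3) (Real.exp_pos _).le

theorem isInnerProduct_sobolevInner {α : ℝ} (hα : -1 < α) (c : ℝ) {M N : ℝ} (hM : 0 ≤ M)
    (hN : 0 ≤ N) : IsInnerProduct (sobolevInner α c M N) where
  add_left f g h := by
    unfold sobolevInner
    rw [(isInnerProduct_laguerreInner hα).add_left]
    simp only [eval_add, derivative_add]; ring
  smul_left a f g := by
    unfold sobolevInner
    rw [(isInnerProduct_laguerreInner hα).smul_left]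
    simp only [eval_mul, derivative_C_mul, eval_C]; ring
  symm f g := by
    unfold sobolevInner
    rw [(isInnerProduct_laguerreInner hα).symm]
    ring
  pos f hf := by
    unfold sobolevInner
    have h1 := (isInnerProduct_laguerreInner hα).pos f hf
    have h2 := mul_nonneg hM (mul_self_nonneg (f.eval c))
    have h3 := mul_nonneg hN (mul_self_nonneg ((derivative f).eval c))
    rw [mul_assoc M, mul_assoc N]
    linarith

end LaguerreSobolev

end

open Polynomial MeasureTheory Filter Topology

noncomputable section

namespace LaguerreSobolev

/-! The identities are algebraic. Sobolev orthogonality turns the Laguerre-Fourier coefficients of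
S_n into values of S_n and S_n' at c, so S_n is L_n minus multiples of two kernels, K(x, c) and its
derivative in the second variable. Christoffel-Darboux clears the first with one factor x - c and
the second with two. The five-term form then follows from the recurrence at n - 1, n and n + 1.

For the limits it suffices that A_1 = o(n), A_0 and B_1 = o(n^2), B_0 = o(n^3). All four are
controlled by the excess ρ_n = ‖S_n‖_S^2 / ‖L_n‖_α^2 - 1: B_1 equals γ_n ρ_n, A_1^2 is at most γ_n
ρ_n by Cauchy-Schwarz, and A_0^2, B_0^2 are bounded by multiples of γ_n ρ_n and γ_n^2 ρ_n
(`coeffB1_succ`, `coeffA1_succ_sq_le`, `exists_coeffA0_coeffB0_bound`).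

That ρ_n tends to 0 (`tendsto_sobolevExcess`) comes from extremality: S_n minimizes the Sobolev norm
among monic polynomials of degree n. With orthonormal Q_k, the competitor is a multiple of Q_n - E,
where E averages 2 Q_{n-a} - Q_{n-2a} over 1 ≤ a ≤ m. Orthogonality gives ‖E‖^2 ≤ 10/m, while at c
the value and derivative of Q_n - E are averages of second differences, which vanish as n grows with
m fixed. Indeed, with alternating signs the recurrence is a perturbation of u_{n+2} - 2u_{n+1} + u_n
= 0 of relative size 1/n, and Q_n(c) = O(1), Q_n'(c) = O(√n). These last bounds come from the Sonin
function n L_n^2 + x L_n'^2, whose value at c is compared with its integral. -/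

/-! ### Inner products and monic orthogonal sequences -/

theorem IsInnerProduct.add_right {B : ℝ[X] → ℝ[X] → ℝ} (hB : IsInnerProduct B) (f g h : ℝ[X]) :
    B f (g + h) = B f g + B f h := by
  rw [hB.symm, hB.add_left, hB.symm g, hB.symm h]

theorem IsInnerProduct.sub_right {B : ℝ[X] → ℝ[X] → ℝ} (hB : IsInnerProduct B) (f g h : ℝ[X]) :
    B f (g - h) = B f g - B f h := by
  rw [hB.symm, hB.sub_left, hB.symm g, hB.symm h]

theorem IsInnerProduct.smul_right {B : ℝ[X] → ℝ[X] → ℝ} (hB : IsInnerProduct B) (a : ℝ)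
    (f g : ℝ[X]) : B f (C a * g) = a * B f g := by
  rw [hB.symm, hB.smul_left, hB.symm]

theorem IsInnerProduct.zero_right {B : ℝ[X] → ℝ[X] → ℝ} (hB : IsInnerProduct B) (f : ℝ[X]) :
    B f 0 = 0 := by
  rw [hB.symm, hB.zero_left]

theorem IsInnerProduct.sum_right {B : ℝ[X] → ℝ[X] → ℝ} (hB : IsInnerProduct B) {ι : Type}
    (s : Finset ι) (F : ι → ℝ[X]) (g : ℝ[X]) : B g (∑ i ∈ s, F i) = ∑ i ∈ s, B g (F i) := by
  rw [hB.symm, hB.sum_left]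
  exact Finset.sum_congr rfl fun i _ => hB.symm _ _

theorem IsInnerProduct.nonneg {B : ℝ[X] → ℝ[X] → ℝ} (hB : IsInnerProduct B) (f : ℝ[X]) :
    0 ≤ B f f := by
  rcases eq_or_ne f 0 with rfl | h
  · rw [hB.zero_left]
  · exact (hB.pos f h).le

theorem IsInnerProduct.eq_zero_of_self {B : ℝ[X] → ℝ[X] → ℝ} (hB : IsInnerProduct B) {f : ℝ[X]}
    (h : B f f = 0) : f = 0 := by
  by_contra hf
  exact (hB.pos f hf).ne' h

theorem IsInnerProduct.sq_le {B : ℝ[X] → ℝ[X] → ℝ} (hB : IsInnerProduct B) (f g : ℝ[X]) :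
    B f g ^ 2 ≤ B f f * B g g := by
  rcases eq_or_ne g 0 with rfl | h
  · simp [hB.zero_right]
  · have hg := hB.pos g h
    have h1 := hB.nonneg (C (B g g) * f - C (B f g) * g)
    simp only [hB.sub_left, hB.sub_right, hB.smul_left, hB.smul_right, hB.symm g f] at h1
    have h2 : 0 ≤ B g g * (B f f * B g g - B f g ^ 2) := by nlinarith
    have := nonneg_of_mul_nonneg_right h2 hg
    linarith

theorem IsInnerProduct.sub_self_le {B : ℝ[X] → ℝ[X] → ℝ} (hB : IsInnerProduct B) (f g : ℝ[X]) :
    B (f - g) (f - g) ≤ 2 * (B f f + B g g) := by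
  have h := hB.nonneg (f + g)
  simp only [hB.add_left, hB.add_right] at h
  simp only [hB.sub_left, hB.sub_right]
  linarith

theorem IsInnerProduct.isMonicOrthogonal {B : ℝ[X] → ℝ[X] → ℝ} (hB : IsInnerProduct B) :
    IsMonicOrthogonal B (monicOP B) :=
  (isMonicOrthogonal_iff hB _).2 rfl

theorem IsMonicOrthogonal.degree_eq {B : ℝ[X] → ℝ[X] → ℝ} {P : ℕ → ℝ[X]}
    (hP : IsMonicOrthogonal B P) (n : ℕ) : (P n).degree = n := by
  rw [degree_eq_natDegree (hP.monic n).ne_zero, hP.natDegree_eq]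

theorem IsMonicOrthogonal.coeff_self {B : ℝ[X] → ℝ[X] → ℝ} {P : ℕ → ℝ[X]}
    (hP : IsMonicOrthogonal B P) (n : ℕ) : (P n).coeff n = 1 := by
  have := hP.monic n
  rwa [Monic, leadingCoeff, hP.natDegree_eq] at this

theorem IsMonicOrthogonal.coeff_of_lt {B : ℝ[X] → ℝ[X] → ℝ} {P : ℕ → ℝ[X]}
    (hP : IsMonicOrthogonal B P) {n k : ℕ} (h : n < k) : (P n).coeff k = 0 :=
  coeff_eq_zero_of_natDegree_lt (by rwa [hP.natDegree_eq])

theorem IsMonicOrthogonal.sub_degree_lt {B B' : ℝ[X] → ℝ[X] → ℝ} {P P' : ℕ → ℝ[X]}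
    (hP : IsMonicOrthogonal B P) (hP' : IsMonicOrthogonal B' P') (n : ℕ) :
    (P n - P' n).degree < n := by
  rw [degree_lt_iff_coeff_zero]
  intro k hk
  rcases hk.eq_or_lt with rfl | hk
  · simp [hP.coeff_self, hP'.coeff_self]
  · simp [hP.coeff_of_lt hk, hP'.coeff_of_lt hk]

/-- Peeling off top coefficients shows that P_0, ..., P_{n-1} span all polynomials of degree below
n. Only the degrees of P matter, so B' may differ from B. -/
theorem IsMonicOrthogonal.inner_eq_zero {B B' : ℝ[X] → ℝ[X] → ℝ} (hB : IsInnerProduct B)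
    {P : ℕ → ℝ[X]} (hP : IsMonicOrthogonal B' P) {f : ℝ[X]} {n : ℕ}
    (h : ∀ j < n, B f (P j) = 0) {q : ℝ[X]} (hq : q.degree < n) : B f q = 0 := by
  induction n generalizing q with
  | zero =>
    have : q = 0 := by
      rw [← degree_eq_bot]
      simpa using hq
    rw [this, hB.zero_right]
  | succ m ih =>
    have h2 : (q - C (q.coeff m) * P m).degree < (m : WithBot ℕ) := by
      rw [degree_lt_iff_coeff_zero]
      intro j hj
      rcases hj.eq_or_lt with rfl | hj
      · simp [hP.coeff_self]
      · have e1 : q.coeff j = 0 := (degree_lt_iff_coeff_zero q (m + 1)).1 hq j hj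
        simp [e1, hP.coeff_of_lt hj]
    have h1 : q = (q - C (q.coeff m) * P m) + C (q.coeff m) * P m := by ring
    rw [h1, hB.add_right, hB.smul_right, ih (fun j hj => h j (by omega)) h2, h m (by omega)]
    simp

/-- Such an f is orthogonal to itself. This is the device behind the differential equation, the
recurrence and the Fourier expansion: compare top coefficients, then test against lower Laguerre
polynomials. -/
theorem IsMonicOrthogonal.eq_zero {B B' : ℝ[X] → ℝ[X] → ℝ} (hB : IsInnerProduct B)
    {P : ℕ → ℝ[X]} (hP : IsMonicOrthogonal B' P) {f : ℝ[X]} {n : ℕ} (hf : f.degree < n)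
    (h : ∀ j < n, B f (P j) = 0) : f = 0 :=
  hB.eq_zero_of_self (hP.inner_eq_zero hB h hf)

/-! ### Laguerre polynomials: differential equation, recurrence, norms -/

/-- The monic Laguerre polynomials indexed by natural numbers. -/
def lag (α : ℝ) (n : ℕ) : ℝ[X] := monicOP (laguerreInner α) n

/-- The squared norms of the monic Laguerre polynomials. -/
def lagNormSq (α : ℝ) (n : ℕ) : ℝ := laguerreInner α (lag α n) (lag α n)

theorem isMonicOrthogonal_lag {α : ℝ} (hα : -1 < α) :
    IsMonicOrthogonal (laguerreInner α) (lag α) :=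
  (isInnerProduct_laguerreInner hα).isMonicOrthogonal

theorem lagNormSq_pos {α : ℝ} (hα : -1 < α) (n : ℕ) : 0 < lagNormSq α n :=
  (isInnerProduct_laguerreInner hα).pos _ ((isMonicOrthogonal_lag hα).monic n).ne_zero

theorem laguerreInner_eq_mul_one (α : ℝ) (f g : ℝ[X]) :
    laguerreInner α f g = laguerreInner α (f * g) 1 := by
  simp [laguerreInner]

theorem laguerreInner_mul_left (α : ℝ) (p f g : ℝ[X]) :
    laguerreInner α (p * f) g = laguerreInner α f (p * g) := by
  rw [laguerreInner_eq_mul_one, laguerreInner_eq_mul_one α f, mul_assoc, mul_left_comm]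

theorem laguerreInner_X_pow_one {α : ℝ} (hα : -1 < α) (k : ℕ) :
    laguerreInner α (X ^ k) 1 = Real.Gamma (k + α + 1) := by
  have h : (0 : ℝ) ≤ k := Nat.cast_nonneg k
  rw [laguerreInner, Real.Gamma_eq_integral (by linarith)]
  refine setIntegral_congr_fun measurableSet_Ioi fun x hx => ?_
  have hx' : (0 : ℝ) < x := hx
  simp only [eval_pow, eval_X, eval_one]
  rw [show (k : ℝ) + α + 1 - 1 = k + α by ring, Real.rpow_add hx', Real.rpow_natCast]
  ring

/-- The integral of (x p w)' vanishes for the weight w = x^α e^{-x}. On monomials this is Γ(s + 1) =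
s Γ(s), so no boundary terms have to be discussed. -/
theorem laguerreInner_pearson {α : ℝ} (hα : -1 < α) (p : ℝ[X]) :
    laguerreInner α (X * derivative p + (C (α + 1) - X) * p) 1 = 0 := by
  have hB := isInnerProduct_laguerreInner hα
  induction p using Polynomial.induction_on' with
  | add p q hp hq =>
    rw [show X * derivative (p + q) + (C (α + 1) - X) * (p + q)
      = (X * derivative p + (C (α + 1) - X) * p) + (X * derivative q + (C (α + 1) - X) * q) by
        rw [derivative_add]; ring, hB.add_left, hp, hq, add_zero]
  | monomial k a =>
    have e : X * derivative (monomial k a) + (C (α + 1) - X) * monomial k a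
        = C (a * (k + α + 1)) * X ^ k - C a * X ^ (k + 1) := by
      rw [← C_mul_X_pow_eq_monomial, derivative_C_mul, derivative_X_pow]
      rcases k with _ | k
      · simp; ring
      · simp [pow_succ]; ring
    have h : (0 : ℝ) ≤ k := Nat.cast_nonneg k
    rw [e, hB.sub_left, hB.smul_left, hB.smul_left, laguerreInner_X_pow_one hα,
      laguerreInner_X_pow_one hα]
    push_cast
    rw [show (k : ℝ) + 1 + α + 1 = (k + α + 1) + 1 by ring,
      Real.Gamma_add_one (by linarith : (0 : ℝ) < k + α + 1).ne']
    ring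

/-- The Laguerre differential operator `f ↦ x f'' + (α + 1 - x) f'`. -/
def lagOp (α : ℝ) (f : ℝ[X]) : ℝ[X] :=
  X * derivative (derivative f) + (C (α + 1) - X) * derivative f

/-- Integration by parts: the Pearson identity applied to f' g. -/
theorem laguerreInner_lagOp {α : ℝ} (hα : -1 < α) (f g : ℝ[X]) :
    laguerreInner α (lagOp α f) g = -laguerreInner α (X * derivative f) (derivative g) := by
  have hB := isInnerProduct_laguerreInner hα
  have h := laguerreInner_pearson hα (derivative f * g)
  rw [show X * derivative (derivative f * g) + (C (α + 1) - X) * (derivative f * g)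
    = lagOp α f * g + X * derivative f * derivative g by
      rw [derivative_mul, lagOp]; ring, hB.add_left, ← laguerreInner_eq_mul_one,
      ← laguerreInner_eq_mul_one] at h
  linarith

theorem laguerreInner_lagOp_comm {α : ℝ} (hα : -1 < α) (f g : ℝ[X]) :
    laguerreInner α (lagOp α f) g = laguerreInner α f (lagOp α g) := by
  have hB := isInnerProduct_laguerreInner hα
  rw [laguerreInner_lagOp hα, hB.symm f, laguerreInner_lagOp hα, hB.symm,
    laguerreInner_mul_left α X]

theorem coeff_lagOp (α : ℝ) (f : ℝ[X]) (k : ℕ) :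
    (lagOp α f).coeff k = (k + 1) * (k + 1 + α) * f.coeff (k + 1) - k * f.coeff k := by
  rw [lagOp, sub_mul, coeff_add, coeff_sub, coeff_C_mul]
  rcases k with _ | k
  · simp only [mul_coeff_zero, coeff_X_zero, coeff_derivative]
    push_cast; ring
  · simp only [coeff_X_mul, coeff_derivative]; push_cast; ring

/-- The operator is symmetric and does not raise degrees, so it maps L_n to a multiple of L_n; the
leading coefficient gives the eigenvalue -n. -/
theorem lagOp_lag {α : ℝ} (hα : -1 < α) (n : ℕ) : lagOp α (lag α n) = -(C (n : ℝ) * lag α n) := by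
  have hB := isInnerProduct_laguerreInner hα
  have hP := isMonicOrthogonal_lag hα
  rw [← sub_eq_zero, sub_neg_eq_add]
  refine hP.eq_zero hB (n := n) ?_ fun j hj => ?_
  · rw [degree_lt_iff_coeff_zero]
    intro k hk
    rw [coeff_add, coeff_lagOp, coeff_C_mul, hP.coeff_of_lt (show n < k + 1 by omega)]
    rcases hk.eq_or_lt with rfl | hk
    · ring
    · rw [hP.coeff_of_lt hk]; ring
  · rw [hB.add_left, hB.smul_left, laguerreInner_lagOp_comm hα, hP.orthogonal _ _ hj.ne',
      hB.symm, hP.eq_zero_of_degree_lt hB n (j + 1) (by omega)]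
    · simp
    · rw [degree_lt_iff_coeff_zero]
      intro k hk
      rw [coeff_lagOp, hP.coeff_of_lt (show j < k by omega),
        hP.coeff_of_lt (show j < k + 1 by omega)]
      ring

theorem coeff_lag_succ {α : ℝ} (hα : -1 < α) (n k : ℕ) :
    ((n : ℝ) - k) * (lag α n).coeff k = -((k + 1) * (k + 1 + α) * (lag α n).coeff (k + 1)) := by
  have h := congrArg (fun p => p.coeff k) (lagOp_lag hα n)
  simp only [coeff_lagOp, coeff_neg, coeff_C_mul] at h
  linarith

theorem coeff_lag_pred {α : ℝ} (hα : -1 < α) (n : ℕ) :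
    (lag α (n + 1)).coeff n = -((n + 1) * (n + 1 + α)) := by
  have h := coeff_lag_succ hα (n + 1) n
  rw [(isMonicOrthogonal_lag hα).coeff_self] at h
  push_cast at h
  linarith

theorem coeff_lag_pred_pred {α : ℝ} (hα : -1 < α) (n : ℕ) :
    (lag α (n + 2)).coeff n = (n + 1) * (n + 1 + α) * ((n + 2) * (n + 2 + α)) / 2 := by
  have h := coeff_lag_succ hα (n + 2) n
  rw [coeff_lag_pred hα (n + 1)] at h
  push_cast at h
  linarith

theorem lag_zero {α : ℝ} (hα : -1 < α) : lag α 0 = 1 :=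
  ((isMonicOrthogonal_lag hα).monic 0).natDegree_eq_zero.1
    ((isMonicOrthogonal_lag hα).natDegree_eq 0)

theorem lag_one {α : ℝ} (hα : -1 < α) : lag α 1 = X - C (α + 1) := by
  have hP := isMonicOrthogonal_lag hα
  ext k
  rcases k with _ | _ | k
  · simpa [add_comm] using coeff_lag_pred hα 0
  · simpa [coeff_one] using hP.coeff_self 1
  · rw [hP.coeff_of_lt (by omega)]
    simp [coeff_X, coeff_one]

/-- The three-term recurrence of the monic Laguerre polynomials. -/
theorem X_mul_lag_succ {α : ℝ} (hα : -1 < α) (n : ℕ) :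
    X * lag α (n + 1) = lag α (n + 2) + C (2 * ((n : ℝ) + 1) + α + 1) * lag α (n + 1)
      + C (((n : ℝ) + 1) * (n + 1 + α)) * lag α n := by
  have hB := isInnerProduct_laguerreInner hα
  have hP := isMonicOrthogonal_lag hα
  rw [← sub_eq_zero]
  -- The coefficients of degree n, n + 1 and n + 2 cancel by their explicit values. For j < n, x L_j
  -- has degree at most n, hence is orthogonal to L_{n+1}.
  refine hP.eq_zero hB (n := n) ?_ fun j hj => ?_
  · rw [degree_lt_iff_coeff_zero]
    intro k hk
    obtain ⟨i, rfl⟩ := Nat.exists_eq_add_of_le hk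
    simp only [coeff_sub, coeff_add, coeff_C_mul]
    rcases i with _ | _ | _ | i
    · rcases n with _ | n
      · have h1 := coeff_lag_pred hα 0
        have h2 := coeff_lag_pred_pred hα 0
        have h3 := hP.coeff_self 0
        simp only [zero_add, add_zero, mul_coeff_zero, coeff_X_zero] at *
        rw [h1, h2, h3]
        push_cast; ring
      · rw [add_zero, coeff_X_mul, coeff_lag_pred_pred hα, coeff_lag_pred_pred hα,
          coeff_lag_pred hα, hP.coeff_self]
        push_cast; ring
    · rw [coeff_X_mul, coeff_lag_pred hα n, coeff_lag_pred hα (n + 1), hP.coeff_self,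
        hP.coeff_of_lt (by omega)]
      push_cast; ring
    · rw [show n + (0 + 1 + 1) = (n + 1) + 1 by ring, coeff_X_mul, hP.coeff_self, hP.coeff_self,
        hP.coeff_of_lt (by omega), hP.coeff_of_lt (by omega)]
      ring
    · rw [show n + (i + 1 + 1 + 1) = (n + i + 2) + 1 by ring, coeff_X_mul,
        hP.coeff_of_lt (by omega), hP.coeff_of_lt (by omega), hP.coeff_of_lt (by omega),
        hP.coeff_of_lt (by omega)]
      ring
  · rw [hB.sub_left, hB.add_left, hB.add_left, hB.smul_left, hB.smul_left,
      hP.orthogonal _ _ (by omega), hP.orthogonal _ _ (by omega), hP.orthogonal _ _ (by omega),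
      laguerreInner_mul_left, hB.symm, hP.eq_zero_of_degree_lt hB _ (j + 2) (by omega)]
    · simp
    · rw [degree_mul, degree_X, hP.degree_eq]
      norm_cast; omega

/-- Two evaluations of ⟨x L_{n+1}, L_n⟩: by the recurrence, and by moving x onto L_n, where x L_n -
L_{n+1} has degree at most n. -/
theorem lagNormSq_succ {α : ℝ} (hα : -1 < α) (n : ℕ) :
    lagNormSq α (n + 1) = ((n : ℝ) + 1) * (n + 1 + α) * lagNormSq α n := by
  have hB := isInnerProduct_laguerreInner hα
  have hP := isMonicOrthogonal_lag hα
  have h1 : laguerreInner α (X * lag α (n + 1)) (lag α n)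
      = ((n : ℝ) + 1) * (n + 1 + α) * lagNormSq α n := by
    rw [X_mul_lag_succ hα, hB.add_left, hB.add_left, hB.smul_left, hB.smul_left,
      hP.orthogonal _ _ (by omega), hP.orthogonal _ _ (by omega), lagNormSq]
    ring
  have h2 : laguerreInner α (X * lag α n - lag α (n + 1)) (lag α (n + 1)) = 0 := by
    refine hP.eq_zero_of_degree_lt hB _ _ le_rfl _ ?_
    rw [degree_lt_iff_coeff_zero]
    intro k hk
    obtain ⟨i, rfl⟩ := Nat.exists_eq_add_of_le hk
    rw [show n + 1 + i = n + i + 1 by ring, coeff_sub, coeff_X_mul]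
    rcases i with _ | i
    · simp [hP.coeff_self]
    · rw [hP.coeff_of_lt (by omega), hP.coeff_of_lt (by omega), sub_zero]
  rw [hB.sub_left, laguerreInner_mul_left, hB.symm, hB.symm] at h2
  rw [← h1, lagNormSq]
  rw [hB.symm (lag α n)] at h2
  linarith

/-- The Dirichlet form of the monic Laguerre polynomials. -/
theorem laguerreInner_X_mul_derivative_lag {α : ℝ} (hα : -1 < α) (n : ℕ) :
    laguerreInner α (X * derivative (lag α n)) (derivative (lag α n)) = n * lagNormSq α n := by
  have hB := isInnerProduct_laguerreInner hα
  have h := laguerreInner_lagOp hα (lag α n) (lag α n)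
  rw [lagOp_lag hα, ← neg_one_mul, show (-1 : ℝ[X]) = C (-1) by simp, hB.smul_left,
    hB.smul_left] at h
  rw [lagNormSq]
  linarith

/-! ### The connection formula -/

theorem laguerre_natCast (α : ℝ) (n : ℕ) : laguerre α n = lag α n := rfl

theorem laguerreNormSq_natCast (α : ℝ) (n : ℕ) : laguerreNormSq α n = lagNormSq α n := rfl

theorem isMonicOrthogonal_sobolev {α : ℝ} (hα : -1 < α) (c : ℝ) {M N : ℝ} (hM : 0 ≤ M)
    (hN : 0 ≤ N) : IsMonicOrthogonal (sobolevInner α c M N) (sobolev α c M N) :=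
  (isInnerProduct_sobolevInner hα c hM hN).isMonicOrthogonal

/-- The Laguerre recurrence in the form used for index `n` and all integers below it. -/
theorem X_mul_laguerre {α : ℝ} (hα : -1 < α) (n : ℕ) :
    X * laguerre α n = laguerre α (n + 1) + C (betaCoeff α n) * laguerre α n
      + C (gammaCoeff α n) * laguerre α (n - 1) := by
  rcases n with _ | n
  · have h : laguerre α ((0 : ℕ) + 1) = lag α 1 := rfl
    rw [h, laguerre_natCast, lag_one hα, lag_zero hα]
    simp [betaCoeff, gammaCoeff]
  · have h : laguerre α ((n + 1 : ℕ) + 1) = lag α (n + 2) := rfl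
    have h' : laguerre α ((n + 1 : ℕ) - 1) = lag α n := by
      rw [← laguerre_natCast]; congr 1; push_cast; ring
    rw [h, h', laguerre_natCast, X_mul_lag_succ hα]
    simp [betaCoeff, gammaCoeff]

theorem laguerreInner_sobolev {α : ℝ} (hα : -1 < α) (c : ℝ) {M N : ℝ} (hM : 0 ≤ M)
    (hN : 0 ≤ N) {n : ℕ} {q : ℝ[X]} (hq : q.degree < n) :
    laguerreInner α (sobolev α c M N n) q
      = -(M * (sobolev α c M N n).eval c * q.eval c
        + N * (derivative (sobolev α c M N n)).eval c * (derivative q).eval c) := by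
  have hS := isInnerProduct_sobolevInner hα c hM hN
  have h := (isMonicOrthogonal_sobolev hα c hM hN).eq_zero_of_degree_lt hS n n le_rfl q hq
  rw [hS.symm, sobolevInner] at h
  linarith

/-- The Fourier expansion of the Laguerre-Sobolev type polynomials in Laguerre polynomials. -/
theorem sobolev_eq_sub_sum {α : ℝ} (hα : -1 < α) (c : ℝ) {M N : ℝ} (hM : 0 ≤ M)
    (hN : 0 ≤ N) (n : ℕ) :
    sobolev α c M N n = lag α n
      - C (M * (sobolev α c M N n).eval c)
        * ∑ k ∈ Finset.range n, C ((lag α k).eval c / lagNormSq α k) * lag α k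
      - C (N * (derivative (sobolev α c M N n)).eval c)
        * ∑ k ∈ Finset.range n, C ((derivative (lag α k)).eval c / lagNormSq α k) * lag α k := by
  have hB := isInnerProduct_laguerreInner hα
  have hP := isMonicOrthogonal_lag hα
  have hsum : ∀ f : ℕ → ℝ, (∑ k ∈ Finset.range n, C (f k) * lag α k).degree < n := by
    intro f
    rw [degree_lt_iff_coeff_zero]
    intro k hk
    rw [finsetSum_coeff]
    refine Finset.sum_eq_zero fun j hj => ?_
    rw [coeff_C_mul, hP.coeff_of_lt ((Finset.mem_range.1 hj).trans_le hk), mul_zero]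
  have hin : ∀ f : ℕ → ℝ, ∀ j < n,
      laguerreInner α (∑ k ∈ Finset.range n, C (f k) * lag α k) (lag α j)
        = f j * lagNormSq α j := by
    intro f j hj
    rw [hB.sum_left, Finset.sum_eq_single j]
    · rw [hB.smul_left, lagNormSq]
    · intro k _ hk
      rw [hB.smul_left, hP.orthogonal _ _ hk, mul_zero]
    · intro h
      exact absurd (Finset.mem_range.2 hj) h
  rw [← sub_eq_zero]
  refine hP.eq_zero hB (n := n) ?_ fun j hj => ?_
  · have h := (isMonicOrthogonal_sobolev hα c hM hN).sub_degree_lt hP n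
    rw [degree_lt_iff_coeff_zero] at h ⊢
    intro k hk
    have h1 := h k hk
    have h2 := fun f => (degree_lt_iff_coeff_zero _ _).1 (hsum f) k hk
    simp only [coeff_sub, coeff_C_mul, h2] at h1 ⊢
    linarith
  · have hj' : (lag α j).degree < n := by
      rw [hP.degree_eq]; exact_mod_cast hj
    have hne := (lagNormSq_pos hα j).ne'
    rw [hB.sub_left, hB.sub_left, hB.sub_left, hB.smul_left, hB.smul_left, hin _ j hj,
      hin _ j hj, hP.orthogonal _ _ hj.ne', laguerreInner_sobolev hα c hM hN hj']
    field_simp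
    ring

/-- The Christoffel-Darboux formula, and its derivative in the second variable. -/
theorem christoffel_darboux {α : ℝ} (hα : -1 < α) (c : ℝ) (n : ℕ) :
    (X - C c) * ∑ k ∈ Finset.range (n + 1), C ((lag α k).eval c / lagNormSq α k) * lag α k
        = C ((lag α n).eval c / lagNormSq α n) * lag α (n + 1)
          - C ((lag α (n + 1)).eval c / lagNormSq α n) * lag α n ∧
    (X - C c) * (∑ k ∈ Finset.range (n + 1),
        C ((derivative (lag α k)).eval c / lagNormSq α k) * lag α k)
        = (∑ k ∈ Finset.range (n + 1), C ((lag α k).eval c / lagNormSq α k) * lag α k)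
          + C ((derivative (lag α n)).eval c / lagNormSq α n) * lag α (n + 1)
          - C ((derivative (lag α (n + 1))).eval c / lagNormSq α n) * lag α n := by
  induction n with
  | zero =>
    simp only [zero_add, Finset.range_one, Finset.sum_singleton, lag_one hα, lag_zero hα]
    constructor
    · simp only [eval_one, eval_sub, eval_X, eval_C, div_eq_mul_inv, C_mul, C_sub, C_1]
      ring
    · simp
  | succ n ih =>
    have hne := (lagNormSq_pos hα n).ne'
    have hn : (0 : ℝ) ≤ n := Nat.cast_nonneg n
    have hg : (n : ℝ) + 1 + α ≠ 0 := (by linarith : (0 : ℝ) < n + 1 + α).ne'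
    have hrec := X_mul_lag_succ hα n
    have h0 := congrArg (fun p => p.eval c) hrec
    have h1 := congrArg (fun p => (derivative p).eval c) hrec
    simp only [eval_mul, eval_add, eval_X, eval_C, derivative_mul, derivative_X, derivative_add,
      derivative_C, one_mul, zero_mul, zero_add] at h0 h1
    have hrec2 : lag α (n + 2) = X * lag α (n + 1) - C (2 * ((n : ℝ) + 1) + α + 1) * lag α (n + 1)
      - C (((n : ℝ) + 1) * (n + 1 + α)) * lag α n := by rw [hrec]; ring
    have e0 : (lag α (n + 2)).eval c = c * (lag α (n + 1)).eval c
      - (2 * ((n : ℝ) + 1) + α + 1) * (lag α (n + 1)).eval c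
      - (((n : ℝ) + 1) * (n + 1 + α)) * (lag α n).eval c := by linarith
    have e1 : (derivative (lag α (n + 2))).eval c = (lag α (n + 1)).eval c
      + c * (derivative (lag α (n + 1))).eval c
      - (2 * ((n : ℝ) + 1) + α + 1) * (derivative (lag α (n + 1))).eval c
      - (((n : ℝ) + 1) * (n + 1 + α)) * (derivative (lag α n)).eval c := by linarith
    -- Puts the induction hypothesis over ‖L_{n+1}‖^2; the factor this creates is the γ_{n+1} of the
    -- recurrence.
    have hq : ∀ t : ℝ, t / lagNormSq α n
        = ((n : ℝ) + 1) * (n + 1 + α) * t / lagNormSq α (n + 1) := fun t => by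
      rw [lagNormSq_succ hα]; field_simp
    obtain ⟨ih1, ih2⟩ := ih
    rw [hq, hq] at ih1 ih2
    constructor
    · rw [Finset.sum_range_succ, mul_add, ih1, e0, hrec2]
      simp only [div_eq_mul_inv, C_mul, C_sub, C_add]
      ring
    · rw [Finset.sum_range_succ, mul_add, ih2, Finset.sum_range_succ _ (n + 1), e1, hrec2]
      simp only [div_eq_mul_inv, C_mul, C_sub, C_add]
      ring

theorem connection_formula {α : ℝ} (hα : -1 < α) (c : ℝ) {M N : ℝ} (hM : 0 ≤ M)
    (hN : 0 ≤ N) {n : ℕ} (hn : 1 ≤ n) :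
    (X - C c) ^ 2 * sobolev α c M N n
      = polyA α c M N n * laguerre α n + polyB α c M N n * laguerre α (n - 1) := by
  obtain ⟨m, rfl⟩ := Nat.exists_eq_add_of_le' hn
  have hm : ((m + 1 : ℕ) : ℤ) - 1 = (m : ℕ) := by push_cast; ring
  obtain ⟨h1, h2⟩ := christoffel_darboux hα c m
  have h := sobolev_eq_sub_sum hα c hM hN (m + 1)
  rw [polyA, polyB, coeffA1, coeffA0, coeffB1, coeffB0, hm]
  simp only [laguerre_natCast, laguerreNormSq_natCast]
  set s := (sobolev α c M N (m + 1)).eval c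
  set s' := (derivative (sobolev α c M N (m + 1))).eval c
  rw [h]
  simp only [div_eq_mul_inv, C_mul, C_sub, C_add, C_neg] at h1 h2 ⊢
  -- The derivative kernel times x - c reproduces the plain kernel, hence the extra multiple of `h1`
  -- without the factor x - c.
  linear_combination (-(C M * C s * (X - C c)) - C N * C s') * h1
    - C N * C s' * (X - C c) * h2

theorem connection_expansion {α : ℝ} (hα : -1 < α) (c : ℝ) {M N : ℝ} (hM : 0 ≤ M)
    (hN : 0 ≤ N) {n : ℕ} (hn : 1 ≤ n) :
    (X - C c) ^ 2 * sobolev α c M N n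
      = laguerre α (n + 2) + C (bTilde α c M N n) * laguerre α (n + 1)
        + C (cTilde α c M N n) * laguerre α n
        + C (dTilde α c M N n) * laguerre α (n - 1)
        + C (eTilde α c M N n) * laguerre α (n - 2) := by
  have r0 := X_mul_laguerre hα n
  have r1 := X_mul_laguerre hα (n + 1)
  have r2 := X_mul_laguerre hα (n - 1)
  -- The hypothesis n ≥ 1 makes the cast of the natural number n - 1 the integer n - 1. For n = 1
  -- the index n - 2 is negative and its polynomial is 0.
  push_cast [hn] at r1 r2
  rw [show (n : ℤ) + 1 + 1 = n + 2 by ring, show (n : ℤ) + 1 - 1 = n by ring] at r1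
  rw [show (n : ℤ) - 1 + 1 = n by ring, show (n : ℤ) - 1 - 1 = n - 2 by ring] at r2
  rw [connection_formula hα c hM hN hn, polyA, polyB, bTilde, cTilde, dTilde, eTilde]
  simp only [C_mul, C_sub, C_add, C_pow, C_ofNat]
  linear_combination (X + C (betaCoeff α n) - 2 * C c + C (coeffA1 α c M N n)) * r0 + r1
    + (C (gammaCoeff α n) + C (coeffB1 α c M N n)) * r2

/-! ### Sonin's function and the size of L_n and L_n' at c -/

/-- The Sonin function `n L_n² + x L_n'²`. -/
def sonin (α : ℝ) (n : ℕ) : ℝ[X] :=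
  C (n : ℝ) * lag α n ^ 2 + X * derivative (lag α n) ^ 2

/-- The weights n and x are chosen so that eliminating x L_n'' by the differential equation also
cancels the terms in L_n L_n'. -/
theorem derivative_sonin {α : ℝ} (hα : -1 < α) (n : ℕ) :
    derivative (sonin α n) = derivative (lag α n) ^ 2 * (2 * X - C (2 * α + 1)) := by
  have h := lagOp_lag hα n
  rw [lagOp] at h
  simp only [sonin, derivative_add, derivative_mul, derivative_C, derivative_X, derivative_pow,
    C_add, C_mul, C_1, C_ofNat] at h ⊢
  push_cast
  simp only [C_ofNat]
  linear_combination 2 * derivative (lag α n) * h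

theorem laguerreInner_sonin {α : ℝ} (hα : -1 < α) (n : ℕ) :
    laguerreInner α (sonin α n) 1 = 2 * n * lagNormSq α n := by
  have hB := isInnerProduct_laguerreInner hα
  have h := laguerreInner_X_mul_derivative_lag hα n
  rw [laguerreInner_eq_mul_one] at h
  rw [sonin, hB.add_left, hB.smul_left, sq, ← laguerreInner_eq_mul_one, sq, ← mul_assoc, h,
    lagNormSq]
  ring

theorem sonin_eval_nonneg (α : ℝ) (n : ℕ) {x : ℝ} (hx : 0 ≤ x) : 0 ≤ (sonin α n).eval x := by
  simp only [sonin, eval_add, eval_mul, eval_C, eval_X, eval_pow]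
  positivity

/-- The Sonin function may decrease where 2x < 2α + 1. For x ≥ c its logarithmic rate of decrease is
at most |2α + 1| / c, because it dominates x L_n'^2; the exponential compensates for this. -/
theorem sonin_mul_exp_monotoneOn {α : ℝ} (hα : -1 < α) {c : ℝ} (hc : 0 < c) (n : ℕ) :
    MonotoneOn (fun x => (sonin α n).eval x * Real.exp ((|2 * α + 1| / c) * x)) (Set.Ici c) := by
  have hd : ∀ x, HasDerivAt (fun x => (sonin α n).eval x * Real.exp ((|2 * α + 1| / c) * x))
      ((derivative (sonin α n)).eval x * Real.exp ((|2 * α + 1| / c) * x)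
        + (sonin α n).eval x * (Real.exp ((|2 * α + 1| / c) * x) * (|2 * α + 1| / c))) x := by
    intro x
    refine ((sonin α n).hasDerivAt x).mul ?_
    simpa using ((hasDerivAt_id x).const_mul (|2 * α + 1| / c)).exp
  refine monotoneOn_of_deriv_nonneg (convex_Ici c)
    (fun x _ => (hd x).continuousAt.continuousWithinAt)
    (fun x _ => (hd x).differentiableAt.differentiableWithinAt) fun x hx => ?_
  rw [interior_Ici] at hx
  have hx' : c < x := hx
  have hx0 : 0 < x := hc.trans hx'
  rw [(hd x).deriv, derivative_sonin hα]
  simp only [sonin, eval_add, eval_mul, eval_C, eval_X, eval_pow, eval_sub, eval_ofNat]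
  set a := (lag α n).eval x
  set b := (derivative (lag α n)).eval x
  have hE := Real.exp_pos ((|2 * α + 1| / c) * x)
  set E := Real.exp ((|2 * α + 1| / c) * x)
  have h1 : 2 * α + 1 ≤ x * (|2 * α + 1| / c) := by
    refine (le_abs_self _).trans ?_
    rw [mul_div_assoc', le_div_iff₀ hc]
    nlinarith [abs_nonneg (2 * α + 1)]
  have h2 : 0 ≤ |2 * α + 1| / c := by positivity
  have h3 : 0 ≤ (n : ℝ) * a ^ 2 * (|2 * α + 1| / c) := by positivity
  have h4 : 0 ≤ b ^ 2 * (2 * x + (x * (|2 * α + 1| / c) - (2 * α + 1))) :=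
    mul_nonneg (sq_nonneg _) (by linarith)
  have : 0 ≤ E * (n * a ^ 2 * (|2 * α + 1| / c)
      + b ^ 2 * (2 * x + (x * (|2 * α + 1| / c) - (2 * α + 1)))) := by positivity
  linarith

/-- The Sonin function at a fixed positive point is of the order of its mean value. -/
theorem exists_sonin_eval_le {α : ℝ} (hα : -1 < α) {c : ℝ} (hc : 0 < c) :
    ∃ K : ℝ, 0 < K ∧ ∀ n : ℕ, (sonin α n).eval c ≤ K * (n * lagNormSq α n) := by
  set k := |2 * α + 1| / c
  have hcont : ContinuousOn (fun x : ℝ => Real.exp (k * (c - x)) * (x ^ α * Real.exp (-x)))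
      (Set.Icc c (c + 1)) := by
    refine ContinuousOn.mul (by fun_prop) (ContinuousOn.mul ?_ (by fun_prop))
    intro x hx
    exact (Real.continuousAt_rpow_const x α (Or.inl (hc.trans_le hx.1).ne')).continuousWithinAt
  obtain ⟨x₀, hx₀, hmin⟩ := isCompact_Icc.exists_isMinOn
    (Set.nonempty_Icc.2 (by linarith : c ≤ c + 1)) hcont
  -- The minimum over [c, c + 1] of the weight times the possible loss exp(k (c - x)). Thus δ times
  -- the Sonin value at c is at most its weighted integral over this unit interval, hence at most 2
  -- n ‖L_n‖^2.
  set δ := Real.exp (k * (c - x₀)) * (x₀ ^ α * Real.exp (-x₀))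
  have hδ : 0 < δ := by
    have := Real.rpow_pos_of_pos (hc.trans_le hx₀.1) α
    positivity
  refine ⟨2 / δ, by positivity, fun n => ?_⟩
  have hint := laguerre_integrable hα (sonin α n)
  have hsub : Set.Icc c (c + 1) ⊆ Set.Ioi 0 := fun x hx => hc.trans_le hx.1
  have h1 : δ * (sonin α n).eval c ≤ ∫ x in Set.Icc c (c + 1),
      (sonin α n).eval x * x ^ α * Real.exp (-x) := by
    have h2 : ∫ _ in Set.Icc c (c + 1), δ * (sonin α n).eval c = δ * (sonin α n).eval c := by
      simp
    rw [← h2]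
    refine setIntegral_mono_on continuousOn_const.integrableOn_Icc (hint.mono_set hsub)
      measurableSet_Icc fun x hx => ?_
    have hm := sonin_mul_exp_monotoneOn hα hc n (Set.mem_Ici.2 le_rfl) (Set.mem_Ici.2 hx.1) hx.1
    have hx0 : 0 < x := hsub hx
    have hr := Real.rpow_pos_of_pos hx0 α
    have h3 : (sonin α n).eval c * Real.exp (k * (c - x)) ≤ (sonin α n).eval x := by
      have h4 : Real.exp (k * (c - x)) = Real.exp (k * c) * (Real.exp (k * x))⁻¹ := by
        rw [← Real.exp_neg, ← Real.exp_add]; congr 1; ring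
      rw [h4, ← mul_assoc, ← div_eq_mul_inv, div_le_iff₀ (Real.exp_pos _)]
      exact hm
    have h5 : δ ≤ Real.exp (k * (c - x)) * (x ^ α * Real.exp (-x)) := hmin hx
    calc δ * (sonin α n).eval c
        ≤ Real.exp (k * (c - x)) * (x ^ α * Real.exp (-x)) * (sonin α n).eval c :=
          mul_le_mul_of_nonneg_right h5 (sonin_eval_nonneg α n hc.le)
      _ = (sonin α n).eval c * Real.exp (k * (c - x)) * (x ^ α * Real.exp (-x)) := by ring
      _ ≤ (sonin α n).eval x * (x ^ α * Real.exp (-x)) :=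
          mul_le_mul_of_nonneg_right h3 (by positivity)
      _ = _ := by ring
  have h6 : ∫ x in Set.Icc c (c + 1), (sonin α n).eval x * x ^ α * Real.exp (-x)
      ≤ ∫ x in Set.Ioi 0, (sonin α n).eval x * x ^ α * Real.exp (-x) := by
    refine setIntegral_mono_set hint ?_ hsub.eventuallyLE
    refine (ae_restrict_iff' measurableSet_Ioi).2 (Eventually.of_forall fun x hx => ?_)
    have hx0 : (0 : ℝ) < x := hx
    have := Real.rpow_pos_of_pos hx0 α
    have := sonin_eval_nonneg α n hx0.le
    show 0 ≤ _
    positivity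
  have h7 : ∫ x in Set.Ioi 0, (sonin α n).eval x * x ^ α * Real.exp (-x)
      = 2 * n * lagNormSq α n := by
    rw [← laguerreInner_sonin hα, laguerreInner]
    simp
  rw [div_mul_eq_mul_div, le_div_iff₀ hδ]
  linarith

theorem exists_lag_eval_bound {α : ℝ} (hα : -1 < α) {c : ℝ} (hc : 0 < c) :
    ∃ K : ℝ, 0 < K ∧ ∀ n : ℕ, (lag α n).eval c ^ 2 ≤ K * lagNormSq α n ∧
      (derivative (lag α n)).eval c ^ 2 ≤ K * (n * lagNormSq α n) := by
  obtain ⟨K, hK, h⟩ := exists_sonin_eval_le hα hc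
  -- The three terms serve L_n^2 for n ≥ 1, the case n = 0 where the Sonin bound says nothing about
  -- L_0, and L_n'^2.
  refine ⟨K + (lagNormSq α 0)⁻¹ + K / c, ?_, fun n => ?_⟩
  · have := lagNormSq_pos hα 0
    positivity
  have h0 := lagNormSq_pos hα 0
  have hn := lagNormSq_pos hα n
  have hs := h n
  simp only [sonin, eval_add, eval_mul, eval_C, eval_X, eval_pow] at hs
  have e1 : 0 ≤ (n : ℝ) * (lag α n).eval c ^ 2 := by positivity
  have e2 : 0 ≤ c * (derivative (lag α n)).eval c ^ 2 := by positivity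
  constructor
  · rcases n.eq_zero_or_pos with rfl | hpos
    · have e3 : (lagNormSq α 0)⁻¹ * lagNormSq α 0 = 1 := inv_mul_cancel₀ h0.ne'
      have e4 : 0 ≤ (K + K / c) * lagNormSq α 0 := by positivity
      rw [lag_zero hα, eval_one]
      linarith
    · have hpos' : (0 : ℝ) < n := by exact_mod_cast hpos
      have e3 : (lag α n).eval c ^ 2 ≤ K * lagNormSq α n := by
        refine le_of_mul_le_mul_left ?_ hpos'
        linarith
      have e4 : 0 ≤ ((lagNormSq α 0)⁻¹ + K / c) * lagNormSq α n := by positivity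
      linarith
  · have e3 : (derivative (lag α n)).eval c ^ 2 ≤ K / c * (n * lagNormSq α n) := by
      rw [div_mul_eq_mul_div, le_div_iff₀ hc]
      linarith
    have e4 : 0 ≤ (K + (lagNormSq α 0)⁻¹) * (n * lagNormSq α n) := by positivity
    linarith

/-! ### Second differences of the orthonormal polynomials at c -/

theorem tendsto_shift_sub {u : ℕ → ℝ} (h : Tendsto (fun n => u (n + 1) - u n) atTop (𝓝 0))
    (a : ℕ) : Tendsto (fun n => u (n + a) - u n) atTop (𝓝 0) := by
  induction a with
  | zero => simp
  | succ a ih =>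
    have h1 := (h.comp (tendsto_add_atTop_nat a)).add ih
    rw [add_zero] at h1
    refine h1.congr fun n => ?_
    simp only [Function.comp_apply]
    rw [add_assoc]
    ring

/-- A difference of step a is a sum of a shifted unit differences; this is used once for each of the
two differences. -/
theorem tendsto_shift_second_diff {u : ℕ → ℝ}
    (h : Tendsto (fun n => u (n + 2) - 2 * u (n + 1) + u n) atTop (𝓝 0)) (a : ℕ) :
    Tendsto (fun n => u (n + a + a) - 2 * u (n + a) + u n) atTop (𝓝 0) := by
  have h1 : Tendsto (fun n => (u (n + 1 + 1) - u (n + 1)) - (u (n + 1) - u n)) atTop (𝓝 0) :=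
    h.congr fun n => by rw [add_assoc]; ring
  have h2 := tendsto_shift_sub (u := fun n => u (n + 1) - u n) h1 a
  have h3 : Tendsto (fun n => (u (n + 1 + a) - u (n + 1)) - (u (n + a) - u n)) atTop (𝓝 0) :=
    h2.congr fun n => by rw [show n + 1 + a = n + a + 1 by ring]; ring
  exact (tendsto_shift_sub (u := fun n => u (n + a) - u n) h3 a).congr fun n => by ring

/-- The orthonormal Laguerre polynomials with positive value at the origin. -/
def orthoLag (α : ℝ) (n : ℕ) : ℝ[X] := C ((-1) ^ n / √(lagNormSq α n)) * lag α n

theorem laguerreInner_orthoLag {α : ℝ} (hα : -1 < α) (m n : ℕ) :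
    laguerreInner α (orthoLag α m) (orthoLag α n) = if m = n then 1 else 0 := by
  have hB := isInnerProduct_laguerreInner hα
  rw [orthoLag, orthoLag, hB.smul_left, hB.smul_right]
  split_ifs with h
  · subst h
    have hp := lagNormSq_pos hα m
    have hs := Real.sqrt_pos.2 hp
    change _ * (_ * lagNormSq α m) = 1
    nth_rw 3 [← Real.sq_sqrt hp.le]
    have : ((-1 : ℝ) ^ m) * (-1) ^ m = 1 := by rw [← mul_pow]; simp
    field_simp
    rw [sq, this]
  · rw [(isMonicOrthogonal_lag hα).orthogonal _ _ h]; simp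

/-- The off-diagonal entries `√(n (n + α))` of the Jacobi matrix. -/
def jacobiOff (α : ℝ) (n : ℕ) : ℝ := √((n : ℝ) * (n + α))

theorem sqrt_lagNormSq_succ {α : ℝ} (hα : -1 < α) (n : ℕ) :
    √(lagNormSq α (n + 1)) = jacobiOff α (n + 1) * √(lagNormSq α n) := by
  have hn : (0 : ℝ) ≤ n := Nat.cast_nonneg n
  rw [lagNormSq_succ hα, jacobiOff, ← Real.sqrt_mul]
  · push_cast; rfl
  · push_cast
    exact mul_nonneg (by linarith) (by linarith)

theorem jacobiOff_succ_pos {α : ℝ} (hα : -1 < α) (n : ℕ) : 0 < jacobiOff α (n + 1) := by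
  have hn : (0 : ℝ) ≤ n := Nat.cast_nonneg n
  refine Real.sqrt_pos.2 (mul_pos ?_ ?_) <;> push_cast <;> linarith

/-- The difference of squares is (n + 1) α, and it is divided by a sum that is at least n + 1. -/
theorem abs_jacobiOff_sub_le {α : ℝ} (hα : -1 < α) (n : ℕ) :
    |jacobiOff α (n + 1) - (n + 1)| ≤ |α| := by
  have hn : (0 : ℝ) ≤ n := Nat.cast_nonneg n
  have hp := jacobiOff_succ_pos hα n
  have hsq : jacobiOff α (n + 1) ^ 2 = ((n : ℝ) + 1) * (n + 1 + α) := by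
    rw [jacobiOff, Real.sq_sqrt]
    · push_cast; rfl
    · push_cast
      exact mul_nonneg (by linarith) (by linarith)
  have h1 : |jacobiOff α (n + 1) - (n + 1)| * (jacobiOff α (n + 1) + (n + 1)) = (n + 1) * |α| := by
    rw [← abs_of_pos (by linarith : 0 < jacobiOff α (n + 1) + ((n : ℝ) + 1)), ← abs_mul,
      ← abs_of_pos (by linarith : 0 < (n : ℝ) + 1), ← abs_mul,
      abs_of_pos (by linarith : 0 < (n : ℝ) + 1)]
    congr 1
    linarith
  have h2 : |jacobiOff α (n + 1) - (n + 1)| * (n + 1) ≤ |α| * (n + 1) := by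
    have := mul_nonneg (abs_nonneg (jacobiOff α (n + 1) - (n + 1))) hp.le
    linarith
  exact le_of_mul_le_mul_right h2 (by linarith)

/-- The alternating sign makes the off-diagonal terms enter so that, after division by n, the
leading part is u_{n+2} = 2 u_{n+1} - u_n. -/
theorem orthoLag_recurrence {α : ℝ} (hα : -1 < α) (n : ℕ) :
    C (jacobiOff α (n + 2)) * orthoLag α (n + 2)
      = C (2 * ((n : ℝ) + 1) + α + 1) * orthoLag α (n + 1) - X * orthoLag α (n + 1)
        - C (jacobiOff α (n + 1)) * orthoLag α n := by
  have hrec := X_mul_lag_succ hα n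
  have hp := jacobiOff_succ_pos hα n
  have hp' := jacobiOff_succ_pos hα (n + 1)
  have hs := Real.sqrt_pos.2 (lagNormSq_pos hα n)
  have hn : (0 : ℝ) ≤ n := Nat.cast_nonneg n
  have hsq : ((n : ℝ) + 1) * (n + 1 + α) = jacobiOff α (n + 1) * jacobiOff α (n + 1) := by
    rw [jacobiOff, Real.mul_self_sqrt]
    · push_cast; rfl
    · push_cast
      exact mul_nonneg (by linarith) (by linarith)
  have e2 : jacobiOff α (n + 2) * ((-1) ^ (n + 2) / √(lagNormSq α (n + 2)))
      = (-1) ^ n / (jacobiOff α (n + 1) * √(lagNormSq α n)) := by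
    rw [sqrt_lagNormSq_succ hα (n + 1), sqrt_lagNormSq_succ hα n, pow_add]
    field_simp
  have e1 : (-1) ^ (n + 1) / √(lagNormSq α (n + 1))
      = -((-1) ^ n / (jacobiOff α (n + 1) * √(lagNormSq α n))) := by
    rw [sqrt_lagNormSq_succ hα n, pow_succ]
    ring
  have e0 : (-1) ^ n / √(lagNormSq α n)
      = jacobiOff α (n + 1) * ((-1) ^ n / (jacobiOff α (n + 1) * √(lagNormSq α n))) := by
    field_simp
  rw [orthoLag, orthoLag, orthoLag, ← mul_assoc, ← C_mul, e2, e1, e0]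
  rw [hsq] at hrec
  set t := (-1) ^ n / (jacobiOff α (n + 1) * √(lagNormSq α n))
  simp only [C_mul, C_neg] at hrec ⊢
  linear_combination -C t * hrec

theorem exists_orthoLag_bound {α : ℝ} (hα : -1 < α) {c : ℝ} (hc : 0 < c) :
    ∃ K : ℝ, 0 < K ∧ ∀ n : ℕ, |(orthoLag α n).eval c| ≤ K ∧
      |(derivative (orthoLag α n)).eval c| ≤ K * √n := by
  obtain ⟨K, hK, h⟩ := exists_lag_eval_bound hα hc
  refine ⟨√K, Real.sqrt_pos.2 hK, fun n => ?_⟩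
  have hn := lagNormSq_pos hα n
  have hs := Real.sqrt_pos.2 hn
  obtain ⟨h1, h2⟩ := h n
  have ha : |(-1 : ℝ) ^ n / √(lagNormSq α n)| = 1 / √(lagNormSq α n) := by
    rw [abs_div, abs_pow, abs_neg, abs_one, one_pow, abs_of_pos hs]
  rw [orthoLag, derivative_C_mul, eval_mul, eval_mul, eval_C, abs_mul, abs_mul, ha,
    ← Real.sqrt_mul hK.le]
  constructor
  · rw [one_div_mul_eq_div, div_le_iff₀ hs, ← Real.sqrt_mul hK.le]
    exact Real.abs_le_sqrt h1
  · rw [one_div_mul_eq_div, div_le_iff₀ hs, ← Real.sqrt_mul (by positivity)]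
    refine Real.abs_le_sqrt (h2.trans_eq (by ring))

/-- Subtracting the ideal recurrence with coefficients n, 2n, n leaves three coefficient errors of
size A, each multiplied by a term of size s, and the forcing term f. -/
theorem abs_second_diff_le {a₂ a₁ b n s u₂ u₁ u₀ f A : ℝ} (hn : 0 < n)
    (h2 : |a₂ - n| ≤ A) (h1 : |a₁ - n| ≤ A) (hb : |b - 2 * n| ≤ A)
    (hrec : a₂ * u₂ = b * u₁ - a₁ * u₀ - f)
    (hu₂ : |u₂| ≤ s) (hu₁ : |u₁| ≤ s) (hu₀ : |u₀| ≤ s) :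
    |u₂ - 2 * u₁ + u₀| ≤ (3 * A * s + |f|) / n := by
  have hA : 0 ≤ A := (abs_nonneg _).trans h2
  rw [le_div_iff₀ hn, ← abs_of_pos hn, ← abs_mul]
  have e : (u₂ - 2 * u₁ + u₀) * n = (b - 2 * n) * u₁ - (a₂ - n) * u₂ - (a₁ - n) * u₀ - f := by
    linarith
  rw [e]
  have k1 : |(b - 2 * n) * u₁| ≤ A * s := by
    rw [abs_mul]; exact mul_le_mul hb hu₁ (abs_nonneg _) hA
  have k2 : |(a₂ - n) * u₂| ≤ A * s := by
    rw [abs_mul]; exact mul_le_mul h2 hu₂ (abs_nonneg _) hA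
  have k3 : |(a₁ - n) * u₀| ≤ A * s := by
    rw [abs_mul]; exact mul_le_mul h1 hu₀ (abs_nonneg _) hA
  have m1 := abs_sub ((b - 2 * n) * u₁ - (a₂ - n) * u₂ - (a₁ - n) * u₀) f
  have m2 := abs_sub ((b - 2 * n) * u₁ - (a₂ - n) * u₂) ((a₁ - n) * u₀)
  have m3 := abs_sub ((b - 2 * n) * u₁) ((a₂ - n) * u₂)
  linarith

theorem tendsto_orthoLag_second_diff {α : ℝ} (hα : -1 < α) {c : ℝ} (hc : 0 < c) :
    Tendsto (fun n => (orthoLag α (n + 2)).eval c - 2 * (orthoLag α (n + 1)).eval c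
      + (orthoLag α n).eval c) atTop (𝓝 0) ∧
    Tendsto (fun n => (derivative (orthoLag α (n + 2))).eval c
      - 2 * (derivative (orthoLag α (n + 1))).eval c
      + (derivative (orthoLag α n)).eval c) atTop (𝓝 0) := by
  obtain ⟨K, hK, h⟩ := exists_orthoLag_bound hα hc
  set A := |α| + 1 + c + 1
  have hA0 : 0 ≤ A := by positivity
  have hmain : ∀ n : ℕ, ∀ u : ℕ → ℝ, ∀ f s : ℝ,
      jacobiOff α (n + 2) * u 2 = (2 * ((n : ℝ) + 1) + α + 1 - c) * u 1
        - jacobiOff α (n + 1) * u 0 - f →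
      |u 2| ≤ s → |u 1| ≤ s → |u 0| ≤ s →
      |u 2 - 2 * u 1 + u 0| ≤ (3 * A * s + |f|) / ((n : ℝ) + 1) := by
    intro n u f s hrec h2 h1 h0
    have hj1 := abs_jacobiOff_sub_le hα n
    have hj2 := abs_jacobiOff_sub_le hα (n + 1)
    refine abs_second_diff_le (by positivity) ?_ (hj1.trans ?_) ?_ hrec h2 h1 h0
    · have e : jacobiOff α (n + 2) - ((n : ℝ) + 1)
          = (jacobiOff α (n + 1 + 1) - (((n + 1 : ℕ) : ℝ) + 1)) + 1 := by push_cast; ring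
      rw [e]
      refine (abs_add_le _ _).trans ?_
      rw [abs_one]
      simp only [A]; linarith
    · simp only [A]; linarith
    · rw [show 2 * ((n : ℝ) + 1) + α + 1 - c - 2 * (n + 1) = α + (1 - c) by ring]
      refine (abs_add_le _ _).trans ?_
      have : |1 - c| ≤ 1 + c := by rw [abs_le]; constructor <;> linarith
      simp only [A]; linarith
  have hdecay : Tendsto (fun n : ℕ => (3 * A + 1) * K * (√(n + 2 : ℕ) / ((n : ℝ) + 1))) atTop
      (𝓝 0) := by
    have h1 : Tendsto (fun n : ℕ => 2 / √((n + 2 : ℕ) : ℝ)) atTop (𝓝 0) :=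
      tendsto_const_nhds.div_atTop (Real.tendsto_sqrt_atTop.comp
        (tendsto_natCast_atTop_atTop.comp (tendsto_add_atTop_nat 2)))
    have h2 : Tendsto (fun n : ℕ => √(n + 2 : ℕ) / ((n : ℝ) + 1)) atTop (𝓝 0) := by
      refine squeeze_zero (fun n => by positivity) (fun n => ?_) h1
      rw [div_le_div_iff₀ (by positivity) (by positivity), Real.mul_self_sqrt (by positivity)]
      push_cast
      have hn : (0 : ℝ) ≤ n := Nat.cast_nonneg n
      linarith
    simpa using h2.const_mul ((3 * A + 1) * K)
  have hsqrt : ∀ {i n : ℕ}, i ≤ n + 2 → √(i : ℝ) ≤ √((n + 2 : ℕ) : ℝ) := fun hi =>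
    Real.sqrt_le_sqrt (by exact_mod_cast hi)
  have hone : ∀ n : ℕ, 1 ≤ √((n + 2 : ℕ) : ℝ) := fun n => by
    rw [Real.one_le_sqrt]; push_cast; linarith [(Nat.cast_nonneg n : (0 : ℝ) ≤ n)]
  constructor
  · refine squeeze_zero_norm (fun n => ?_) hdecay
    have hrec := congrArg (fun p => p.eval c) (orthoLag_recurrence hα n)
    simp only [eval_mul, eval_sub, eval_X, eval_C] at hrec
    have := hmain n (fun i => (orthoLag α (n + i)).eval c) 0 K (by simp only [add_zero]; linarith)
      (h _).1 (h _).1 (h _).1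
    rw [Real.norm_eq_abs]
    refine this.trans ?_
    rw [abs_zero, add_zero, ← mul_div_assoc]
    refine div_le_div_of_nonneg_right ?_ (by positivity)
    have e : 0 ≤ K * √((n + 2 : ℕ) : ℝ) := by positivity
    have e' : 0 ≤ 3 * A * K * (√((n + 2 : ℕ) : ℝ) - 1) :=
      mul_nonneg (by positivity) (by linarith [hone n])
    linarith
  · refine squeeze_zero_norm (fun n => ?_) hdecay
    have hrec := congrArg (fun p => (derivative p).eval c) (orthoLag_recurrence hα n)
    simp only [eval_mul, eval_sub, eval_X, eval_C, derivative_mul,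
      derivative_X, derivative_sub, derivative_C, zero_mul, zero_add, one_mul, eval_add] at hrec
    have hb : ∀ i, i ≤ 2 → |(derivative (orthoLag α (n + i))).eval c| ≤ K * √((n + 2 : ℕ) : ℝ) :=
      fun i hi => (h _).2.trans (mul_le_mul_of_nonneg_left (hsqrt (by omega)) hK.le)
    -- Differentiating the factor x adds the forcing term Q_{n+1}(c), which is bounded. The
    -- derivatives are O(√n), so the second difference is O(1/√n).
    have := hmain n (fun i => (derivative (orthoLag α (n + i))).eval c)
      ((orthoLag α (n + 1)).eval c) (K * √((n + 2 : ℕ) : ℝ))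
      (by simp only [add_zero]; linarith) (hb 2 (by omega)) (hb 1 (by omega)) (hb 0 (by omega))
    rw [Real.norm_eq_abs]
    refine this.trans ?_
    rw [← mul_div_assoc]
    refine div_le_div_of_nonneg_right ?_ (by positivity)
    have e' : 0 ≤ K * (√((n + 2 : ℕ) : ℝ) - 1) := mul_nonneg hK.le (by linarith [hone n])
    have := (h (n + 1)).1
    linarith

/-! ### Extremality and the competitor polynomial -/

/-- Monic orthogonal polynomials minimize the norm among monic polynomials. -/
theorem IsMonicOrthogonal.inner_self_le {B : ℝ[X] → ℝ[X] → ℝ} (hB : IsInnerProduct B)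
    {P : ℕ → ℝ[X]} (hP : IsMonicOrthogonal B P) {n : ℕ} {f : ℝ[X]}
    (hf : (f - P n).degree < n) : B (P n) (P n) ≤ B f f := by
  have h0 := hP.eq_zero_of_degree_lt hB n n le_rfl _ hf
  have h1 := hB.nonneg (f - P n)
  rw [hB.sub_left] at h0
  rw [hB.sub_left, hB.sub_right, hB.symm (P n), hB.sub_left, h0] at h1
  linarith

/-- Pythagoras for m distinct orthonormal vectors. This decay in m is the reason for averaging over
the step a. -/
theorem laguerreInner_mean_orthoLag {α : ℝ} (hα : -1 < α) {m : ℕ} (hm : 0 < m) {φ : ℕ → ℕ}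
    (hφ : Set.InjOn φ (Finset.range m)) :
    laguerreInner α (C (m : ℝ)⁻¹ * ∑ a ∈ Finset.range m, orthoLag α (φ a))
      (C (m : ℝ)⁻¹ * ∑ a ∈ Finset.range m, orthoLag α (φ a)) = (m : ℝ)⁻¹ := by
  have hB := isInnerProduct_laguerreInner hα
  have hm' : (m : ℝ) ≠ 0 := by exact_mod_cast hm.ne'
  have h1 : ∀ a ∈ Finset.range m, laguerreInner α (orthoLag α (φ a))
      (∑ b ∈ Finset.range m, orthoLag α (φ b)) = 1 := by
    intro a ha
    rw [hB.sum_right, Finset.sum_eq_single a]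
    · simp [laguerreInner_orthoLag hα]
    · intro b hb hba
      rw [laguerreInner_orthoLag hα, if_neg fun h => hba (hφ hb ha h.symm)]
    · exact fun h => absurd ha h
  rw [hB.smul_left, hB.smul_right, hB.sum_left, Finset.sum_congr rfl h1]
  simp [hm']

theorem degree_orthoLag_lt {α : ℝ} (hα : -1 < α) {k n : ℕ} (h : k < n) :
    (orthoLag α k).degree < n := by
  rw [orthoLag, C_mul']
  refine (degree_smul_le _ _).trans_lt ?_
  rw [(isMonicOrthogonal_lag hα).degree_eq]
  exact_mod_cast h

/-- The average over `1 ≤ a ≤ m` of `2 Q (n - a) - Q (n - 2 a)`, where `Q` are the orthonormal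
polynomials. -/
def extrapolation (α : ℝ) (m n : ℕ) : ℝ[X] :=
  C 2 * (C (m : ℝ)⁻¹ * ∑ a ∈ Finset.range m, orthoLag α (n - (a + 1)))
    - C (m : ℝ)⁻¹ * ∑ a ∈ Finset.range m, orthoLag α (n - 2 * (a + 1))

/-- The constant is 2 (4 + 1), from the factor 2 on the first mean. The condition 2m ≤ n prevents
truncated subtraction, so the indices in each mean are distinct. -/
theorem laguerreInner_extrapolation_le {α : ℝ} (hα : -1 < α) {m n : ℕ} (hm : 0 < m)
    (hn : 2 * m ≤ n) :
    laguerreInner α (extrapolation α m n) (extrapolation α m n) ≤ 10 * (m : ℝ)⁻¹ := by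
  have hB := isInnerProduct_laguerreInner hα
  refine (hB.sub_self_le _ _).trans ?_
  rw [hB.smul_left, hB.smul_right, laguerreInner_mean_orthoLag hα hm,
    laguerreInner_mean_orthoLag hα hm]
  · linarith
  · intro a ha b hb h
    simp only [Finset.coe_range, Set.mem_Iio] at ha hb h
    omega
  · intro a ha b hb h
    simp only [Finset.coe_range, Set.mem_Iio] at ha hb h
    omega

theorem degree_extrapolation_lt {α : ℝ} (hα : -1 < α) (m : ℕ) {n : ℕ} (hn : 0 < n) :
    (extrapolation α m n).degree < n := by
  rw [degree_lt_iff_coeff_zero]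
  intro k hk
  have h : ∀ j : ℕ, (orthoLag α (n - (j + 1))).coeff k = 0 := fun j =>
    (degree_lt_iff_coeff_zero _ _).1 (degree_orthoLag_lt hα (by omega)) k hk
  simp only [extrapolation, coeff_sub, coeff_C_mul, finsetSum_coeff]
  rw [Finset.sum_eq_zero fun a _ => h a, Finset.sum_eq_zero fun a _ =>
    show (orthoLag α (n - 2 * (a + 1))).coeff k = 0 from h (2 * a + 1)]
  simp

theorem tendsto_mean_second_diff {u : ℕ → ℝ}
    (h : Tendsto (fun n => u (n + 2) - 2 * u (n + 1) + u n) atTop (𝓝 0)) (m : ℕ) :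
    Tendsto (fun n => (m : ℝ)⁻¹ * ∑ a ∈ Finset.range m,
      (u n - 2 * u (n - (a + 1)) + u (n - 2 * (a + 1)))) atTop (𝓝 0) := by
  have h1 : ∀ a ∈ Finset.range m, Tendsto
      (fun n => u n - 2 * u (n - (a + 1)) + u (n - 2 * (a + 1))) atTop (𝓝 0) := by
    intro a _
    refine ((tendsto_shift_second_diff h (a + 1)).comp
      (tendsto_sub_atTop_nat (2 * (a + 1)))).congr' ?_
    filter_upwards [eventually_ge_atTop (2 * (a + 1))] with n hn
    simp only [Function.comp_apply]
    rw [show n - 2 * (a + 1) + (a + 1) + (a + 1) = n by omega,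
      show n - 2 * (a + 1) + (a + 1) = n - (a + 1) by omega]
  simpa using (tendsto_finsetSum _ h1).const_mul (m : ℝ)⁻¹

/-- The functional φ will be evaluation at c, of the polynomial or of its derivative. -/
theorem apply_sub_extrapolation (φ : ℝ[X] →ₗ[ℝ] ℝ) (α : ℝ) {m : ℕ} (hm : 0 < m) (n : ℕ) :
    φ (orthoLag α n - extrapolation α m n) = (m : ℝ)⁻¹ * ∑ a ∈ Finset.range m,
      (φ (orthoLag α n) - 2 * φ (orthoLag α (n - (a + 1)))
        + φ (orthoLag α (n - 2 * (a + 1)))) := by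
  have hm' : (m : ℝ) ≠ 0 := by exact_mod_cast hm.ne'
  simp only [extrapolation, C_mul', map_sub, map_smul, map_sum, smul_eq_mul,
    Finset.sum_add_distrib, Finset.sum_sub_distrib, Finset.sum_const, Finset.card_range,
    nsmul_eq_mul, ← Finset.mul_sum]
  field_simp
  ring

theorem tendsto_sub_extrapolation_eval {α : ℝ} (hα : -1 < α) {c : ℝ} (hc : 0 < c) {m : ℕ}
    (hm : 0 < m) :
    Tendsto (fun n => (orthoLag α n - extrapolation α m n).eval c) atTop (𝓝 0) ∧
    Tendsto (fun n => (derivative (orthoLag α n - extrapolation α m n)).eval c) atTop (𝓝 0) := by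
  obtain ⟨h1, h2⟩ := tendsto_orthoLag_second_diff hα hc
  constructor
  · refine (tendsto_mean_second_diff (u := fun n => (orthoLag α n).eval c) h1 m).congr fun n => ?_
    exact (apply_sub_extrapolation (leval c) α hm n).symm
  · refine (tendsto_mean_second_diff (u := fun n => (derivative (orthoLag α n)).eval c) h2
      m).congr fun n => ?_
    exact (apply_sub_extrapolation (leval c ∘ₗ derivative) α hm n).symm

/-! ### The Sobolev norm excess tends to zero -/

/-- The excess of the squared Sobolev norm of `S_n` over the squared norm of `L_n`, relative to the
latter. -/
def sobolevExcess (α c M N : ℝ) (n : ℕ) : ℝ :=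
  sobolevInner α c M N (sobolev α c M N n) (sobolev α c M N n) / lagNormSq α n - 1

theorem sobolevInner_self {α : ℝ} (hα : -1 < α) (c M N : ℝ) (n : ℕ) :
    sobolevInner α c M N (sobolev α c M N n) (sobolev α c M N n)
      = (sobolevExcess α c M N n + 1) * lagNormSq α n := by
  have := (lagNormSq_pos hα n).ne'
  rw [sobolevExcess]
  field_simp
  ring

/-- Minimality of S_n against s (Q_n - E), with s chosen to make it monic. Since E has degree below
n, its Laguerre part is ‖L_n‖^2 (1 + ‖E‖^2). -/
theorem sobolevExcess_le {α : ℝ} (hα : -1 < α) (c : ℝ) {M N : ℝ} (hM : 0 ≤ M) (hN : 0 ≤ N)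
    {m n : ℕ} (hm : 0 < m) (hn : 2 * m ≤ n) :
    sobolevExcess α c M N n ≤ 10 * (m : ℝ)⁻¹
      + (M * (orthoLag α n - extrapolation α m n).eval c ^ 2
      + N * (derivative (orthoLag α n - extrapolation α m n)).eval c ^ 2) := by
  have hB := isInnerProduct_laguerreInner hα
  have hS := isInnerProduct_sobolevInner hα c hM hN
  have hPS := isMonicOrthogonal_sobolev hα c hM hN
  have hP := isMonicOrthogonal_lag hα
  have hpos := lagNormSq_pos hα n
  have hsq := Real.sqrt_pos.2 hpos
  have hdeg := degree_extrapolation_lt hα m (show 0 < n by omega)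
  set E := extrapolation α m n with hE
  set s : ℝ := (-1) ^ n * √(lagNormSq α n) with hs
  have hone : ((-1 : ℝ) ^ n) * (-1) ^ n = 1 := by rw [← mul_pow]; simp
  have hss : s * s = lagNormSq α n := by
    rw [hs, mul_mul_mul_comm, hone, one_mul, Real.mul_self_sqrt hpos.le]
  have hL : C s * orthoLag α n = lag α n := by
    rw [orthoLag, ← mul_assoc, ← C_mul, hs]
    have : (-1) ^ n * √(lagNormSq α n) * ((-1) ^ n / √(lagNormSq α n)) = 1 := by
      field_simp
      rw [sq, hone]
    rw [this, C_1, one_mul]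
  have hmin : sobolevInner α c M N (sobolev α c M N n) (sobolev α c M N n)
      ≤ sobolevInner α c M N (C s * (orthoLag α n - E)) (C s * (orthoLag α n - E)) := by
    refine hPS.inner_self_le hS ?_
    have h1 := hP.sub_degree_lt hPS n
    rw [degree_lt_iff_coeff_zero] at h1 hdeg ⊢
    intro k hk
    have h2 := h1 k hk
    rw [mul_sub, hL]
    simp only [coeff_sub, coeff_C_mul, hdeg k hk] at h2 ⊢
    linarith
  have horth : laguerreInner α (orthoLag α n) E = 0 := by
    rw [orthoLag, hB.smul_left, hB.symm, hP.eq_zero_of_degree_lt hB n n le_rfl _ hdeg, mul_zero]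
  have hnorm : laguerreInner α (orthoLag α n - E) (orthoLag α n - E)
      = 1 + laguerreInner α E E := by
    rw [hB.sub_left, hB.sub_right, hB.sub_right, hB.symm E, horth, laguerreInner_orthoLag hα,
      if_pos rfl]
    ring
  rw [hS.smul_left, hS.smul_right, ← mul_assoc, hss, sobolevInner_self hα, sobolevInner, hnorm,
    mul_comm] at hmin
  have h1 := le_of_mul_le_mul_left hmin hpos
  have h2 := laguerreInner_extrapolation_le hα hm hn
  linarith

/-- Pythagoras, since S_n - L_n is orthogonal to L_n. The excess thus controls the distance from S_n
to L_n and both point terms at once. -/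
theorem laguerreInner_sobolev_sub_lag {α : ℝ} (hα : -1 < α) (c : ℝ) {M N : ℝ} (hM : 0 ≤ M)
    (hN : 0 ≤ N) (n : ℕ) :
    laguerreInner α (sobolev α c M N n - lag α n) (sobolev α c M N n - lag α n)
      + M * (sobolev α c M N n).eval c ^ 2 + N * (derivative (sobolev α c M N n)).eval c ^ 2
      = sobolevExcess α c M N n * lagNormSq α n := by
  have hB := isInnerProduct_laguerreInner hα
  have hP := isMonicOrthogonal_lag hα
  have h1 := hP.eq_zero_of_degree_lt hB n n le_rfl _
    ((isMonicOrthogonal_sobolev hα c hM hN).sub_degree_lt hP n)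
  have h2 := sobolevInner_self hα c M N n
  rw [hB.sub_left] at h1
  rw [sobolevInner] at h2
  rw [hB.sub_left, hB.sub_right, hB.sub_right, hB.symm (lag α n)]
  rw [lagNormSq] at *
  linarith

theorem sobolevExcess_nonneg {α : ℝ} (hα : -1 < α) (c : ℝ) {M N : ℝ} (hM : 0 ≤ M)
    (hN : 0 ≤ N) (n : ℕ) : 0 ≤ sobolevExcess α c M N n := by
  have h := laguerreInner_sobolev_sub_lag hα c hM hN n
  have h1 := (isInnerProduct_laguerreInner hα).nonneg (sobolev α c M N n - lag α n)
  refine nonneg_of_mul_nonneg_left (b := lagNormSq α n) ?_ (lagNormSq_pos hα n)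
  rw [← h]
  positivity

theorem tendsto_sobolevExcess {α : ℝ} (hα : -1 < α) {c : ℝ} (hc : 0 < c) {M N : ℝ} (hM : 0 ≤ M)
    (hN : 0 ≤ N) : Tendsto (sobolevExcess α c M N) atTop (𝓝 0) := by
  refine tendsto_order.2 ⟨fun a ha => Eventually.of_forall fun n =>
    ha.trans_le (sobolevExcess_nonneg hα c hM hN n), fun ε hε => ?_⟩
  -- First m is fixed so that 10 / m < ε / 2; only then does n grow, making the point terms small.
  obtain ⟨m, hm⟩ := exists_nat_gt (20 / ε)
  have hm0 : (0 : ℝ) < m := (by positivity : 0 < 20 / ε).trans hm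
  have hm1 : 0 < m := by exact_mod_cast hm0
  have hm2 : 10 * (m : ℝ)⁻¹ < ε / 2 := by
    rw [div_lt_iff₀ hε] at hm
    rw [← div_eq_mul_inv, div_lt_iff₀ hm0]
    linarith
  obtain ⟨h1, h2⟩ := tendsto_sub_extrapolation_eval hα hc hm1
  have h3 := ((h1.pow 2).const_mul M).add ((h2.pow 2).const_mul N)
  simp only [ne_eq, OfNat.ofNat_ne_zero, not_false_eq_true, zero_pow, mul_zero, add_zero] at h3
  filter_upwards [h3.eventually_lt_const (half_pos hε), eventually_ge_atTop (2 * m)] with n hn hn'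
  have := sobolevExcess_le hα c hM hN hm1 hn'
  linarith

/-! The coefficients of the connection formula. -/

/-- The numerator is ⟨S_n, L_n⟩_S - ⟨S_n, L_n⟩_α = ‖S_n‖_S^2 - ‖L_n‖_α^2, and ‖L_n‖^2 / ‖L_{n-1}‖^2
= γ_n. -/
theorem coeffB1_succ {α : ℝ} (hα : -1 < α) (c : ℝ) {M N : ℝ} (hM : 0 ≤ M) (hN : 0 ≤ N) (m : ℕ) :
    coeffB1 α c M N (m + 1)
      = sobolevExcess α c M N (m + 1) * (((m : ℝ) + 1) * (m + 1 + α)) := by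
  have hB := isInnerProduct_laguerreInner hα
  have hP := isMonicOrthogonal_lag hα
  have hS := isInnerProduct_sobolevInner hα c hM hN
  have hPS := isMonicOrthogonal_sobolev hα c hM hN
  have hm : ((m + 1 : ℕ) : ℤ) - 1 = (m : ℕ) := by push_cast; ring
  have hne := (lagNormSq_pos hα m).ne'
  have h1 := hPS.eq_zero_of_degree_lt hS (m + 1) (m + 1) le_rfl _ (hPS.sub_degree_lt hP (m + 1))
  have h2 := hP.eq_zero_of_degree_lt hB (m + 1) (m + 1) le_rfl _ (hPS.sub_degree_lt hP (m + 1))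
  rw [hS.sub_left, sobolevInner_self hα, lagNormSq_succ hα, hS.symm, sobolevInner] at h1
  rw [hB.sub_left, ← lagNormSq, lagNormSq_succ hα] at h2
  rw [coeffB1, hm, laguerreNormSq_natCast, laguerre_natCast, ← add_div, div_eq_iff hne]
  linarith

/-- The coefficient equals ⟨S_n - L_n, L_{n-1}⟩_α / ‖L_{n-1}‖^2. Cauchy-Schwarz applies, with ‖S_n -
L_n‖^2 ≤ ρ_n ‖L_n‖^2. -/
theorem coeffA1_succ_sq_le {α : ℝ} (hα : -1 < α) (c : ℝ) {M N : ℝ} (hM : 0 ≤ M) (hN : 0 ≤ N)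
    (m : ℕ) : coeffA1 α c M N (m + 1) ^ 2
      ≤ sobolevExcess α c M N (m + 1) * (((m : ℝ) + 1) * (m + 1 + α)) := by
  have hB := isInnerProduct_laguerreInner hα
  have hP := isMonicOrthogonal_lag hα
  have hm : ((m + 1 : ℕ) : ℤ) - 1 = (m : ℕ) := by push_cast; ring
  have hpos := lagNormSq_pos hα m
  have hdeg : (lag α m).degree < (m + 1 : ℕ) := by
    rw [hP.degree_eq]; exact_mod_cast Nat.lt_succ_self m
  have h1 := laguerreInner_sobolev hα c hM hN hdeg
  have h2 := hB.sq_le (sobolev α c M N (m + 1) - lag α (m + 1)) (lag α m)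
  have h3 := laguerreInner_sobolev_sub_lag hα c hM hN (m + 1)
  rw [hB.sub_left _ _ (lag α m), hP.orthogonal _ _ (Nat.succ_ne_self m), sub_zero, h1,
    ← lagNormSq] at h2
  rw [lagNormSq_succ hα] at h3
  have h4 : coeffA1 α c M N (m + 1)
      = -(M * (sobolev α c M N (m + 1)).eval c * (lag α m).eval c
        + N * (derivative (sobolev α c M N (m + 1))).eval c * (derivative (lag α m)).eval c)
        / lagNormSq α m := by
    rw [coeffA1, hm, laguerreNormSq_natCast, laguerre_natCast]
    ring
  have h5 : 0 ≤ M * (sobolev α c M N (m + 1)).eval c ^ 2 := by positivity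
  have h6 : 0 ≤ N * (derivative (sobolev α c M N (m + 1))).eval c ^ 2 := by positivity
  rw [h4, div_pow, div_le_iff₀ (by positivity)]
  refine h2.trans ?_
  rw [sq (lagNormSq α m), ← mul_assoc]
  refine mul_le_mul_of_nonneg_right ?_ hpos.le
  linarith

theorem sq_mul_derivative_sobolev_le {α : ℝ} (hα : -1 < α) (c : ℝ) {M N : ℝ} (hM : 0 ≤ M)
    (hN : 0 ≤ N) (n : ℕ) :
    (N * (derivative (sobolev α c M N n)).eval c) ^ 2
      ≤ N * (sobolevExcess α c M N n * lagNormSq α n) := by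
  have h3 := laguerreInner_sobolev_sub_lag hα c hM hN n
  have h1 := (isInnerProduct_laguerreInner hα).nonneg (sobolev α c M N n - lag α n)
  have h5 : 0 ≤ M * (sobolev α c M N n).eval c ^ 2 := by positivity
  rw [mul_pow, sq N, mul_assoc]
  refine mul_le_mul_of_nonneg_left ?_ hN
  linarith

/-- The excess bounds (N S_n'(c))^2 by N ρ_n ‖L_n‖^2, and the Sonin estimate bounds L_k(c)^2 by K
‖L_k‖^2 for k = n - 1 and k = n. -/
theorem exists_coeffA0_coeffB0_bound {α : ℝ} (hα : -1 < α) {c : ℝ} (hc : 0 < c) {M N : ℝ}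
    (hM : 0 ≤ M) (hN : 0 ≤ N) : ∃ K : ℝ, ∀ m : ℕ,
      coeffA0 α c M N (m + 1) ^ 2
        ≤ K * sobolevExcess α c M N (m + 1) * (((m : ℝ) + 1) * (m + 1 + α)) ∧
      coeffB0 α c M N (m + 1) ^ 2
        ≤ K * sobolevExcess α c M N (m + 1) * (((m : ℝ) + 1) * (m + 1 + α)) ^ 2 := by
  obtain ⟨K, hK, h⟩ := exists_lag_eval_bound hα hc
  refine ⟨N * K, fun m => ?_⟩
  have hm : ((m + 1 : ℕ) : ℤ) - 1 = (m : ℕ) := by push_cast; ring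
  have hpos := lagNormSq_pos hα m
  have hpos' := lagNormSq_pos hα (m + 1)
  have h1 := sq_mul_derivative_sobolev_le hα c hM hN (m + 1)
  have hρ := sobolevExcess_nonneg hα c hM hN (m + 1)
  have h2 : ∀ k, (N * (derivative (sobolev α c M N (m + 1))).eval c * (lag α k).eval c) ^ 2
      ≤ N * (sobolevExcess α c M N (m + 1) * lagNormSq α (m + 1)) * (K * lagNormSq α k) := by
    intro k
    rw [mul_pow]
    exact mul_le_mul h1 (h k).1 (sq_nonneg _) (by positivity)
  constructor
  · rw [coeffA0, hm, laguerreNormSq_natCast, laguerre_natCast, neg_sq, div_pow,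
      div_le_iff₀ (by positivity)]
    refine (h2 m).trans_eq ?_
    rw [lagNormSq_succ hα]
    ring
  · rw [coeffB0, hm, laguerreNormSq_natCast, laguerre_natCast, div_pow,
      div_le_iff₀ (by positivity)]
    refine (h2 (m + 1)).trans_eq ?_
    rw [lagNormSq_succ hα]
    ring

theorem tendsto_zero_of_sq_le {x y : ℕ → ℝ} (h : ∀ n, x n ^ 2 ≤ y n)
    (hy : Tendsto y atTop (𝓝 0)) : Tendsto x atTop (𝓝 0) := by
  refine squeeze_zero_norm (fun n => ?_) (by simpa using hy.sqrt)
  rw [Real.norm_eq_abs]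
  exact Real.abs_le_sqrt (h n)

theorem tendsto_gamma_div_sq (α : ℝ) :
    Tendsto (fun m : ℕ => ((m : ℝ) + 1) * (m + 1 + α) / ((m : ℝ) + 1) ^ 2) atTop (𝓝 1) := by
  have h : Tendsto (fun m : ℕ => 1 + α * (1 / ((m : ℝ) + 1))) atTop (𝓝 (1 + α * 0)) :=
    (tendsto_one_div_add_atTop_nhds_zero_nat.const_mul α).const_add 1
  rw [mul_zero, add_zero] at h
  refine h.congr fun m => ?_
  have : (0 : ℝ) < m + 1 := by positivity
  field_simp

/-- The coefficients of the connection formula are of lower order than those of `(x - c)² L_n`. -/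
theorem tendsto_coeff {α : ℝ} (hα : -1 < α) {c : ℝ} (hc : 0 < c) {M N : ℝ}
    (hM : 0 ≤ M) (hN : 0 ≤ N) :
    Tendsto (fun n : ℕ => coeffA1 α c M N n / (n : ℝ)) atTop (𝓝 0) ∧
    Tendsto (fun n : ℕ => coeffA0 α c M N n / (n : ℝ) ^ 2) atTop (𝓝 0) ∧
    Tendsto (fun n : ℕ => coeffB1 α c M N n / (n : ℝ) ^ 2) atTop (𝓝 0) ∧
    Tendsto (fun n : ℕ => coeffB0 α c M N n / (n : ℝ) ^ 3) atTop (𝓝 0) := by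
  have hρ := (tendsto_sobolevExcess hα hc hM hN).comp (tendsto_add_atTop_nat 1)
  have hG := tendsto_gamma_div_sq α
  have hE := tendsto_one_div_add_atTop_nhds_zero_nat (𝕜 := ℝ)
  have h1 := hρ.mul hG
  rw [zero_mul] at h1
  obtain ⟨K, hK⟩ := exists_coeffA0_coeffB0_bound hα hc hM hN
  refine ⟨(tendsto_add_atTop_iff_nat 1).1 ?_, (tendsto_add_atTop_iff_nat 1).1 ?_,
    (tendsto_add_atTop_iff_nat 1).1 ?_, (tendsto_add_atTop_iff_nat 1).1 ?_⟩
  · refine tendsto_zero_of_sq_le (fun m => ?_) h1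
    have hm : (0 : ℝ) < m + 1 := by positivity
    push_cast
    rw [div_pow, Function.comp_apply, ← mul_div_assoc]
    exact div_le_div_of_nonneg_right (coeffA1_succ_sq_le hα c hM hN m) (by positivity)
  · have h2 := (h1.const_mul K).mul (hE.pow 2)
    rw [mul_zero, zero_mul] at h2
    refine tendsto_zero_of_sq_le (fun m => ?_) h2
    have hm : (0 : ℝ) < m + 1 := by positivity
    push_cast
    rw [div_pow, div_le_iff₀ (by positivity), Function.comp_apply]
    refine (hK m).1.trans_eq ?_
    field_simp
  · refine h1.congr fun m => ?_
    push_cast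
    rw [coeffB1_succ hα c hM hN, Function.comp_apply, ← mul_div_assoc]
  · have h2 := ((h1.mul hG).const_mul K).mul (hE.pow 2)
    rw [zero_mul, mul_zero, zero_mul] at h2
    refine tendsto_zero_of_sq_le (fun m => ?_) h2
    have hm : (0 : ℝ) < m + 1 := by positivity
    push_cast
    rw [div_pow, div_le_iff₀ (by positivity), Function.comp_apply]
    refine (hK m).2.trans_eq ?_
    field_simp

end LaguerreSobolev

end

/-! ### The theorem -/

open LaguerreSobolev in
theorem lemma4p1 (α c M N : ℝ) (hα : -1 < α) (hc : 0 < c) (hM : 0 ≤ M) (hN : 0 ≤ N) :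
    (∀ n : ℕ, 1 ≤ n →
      (X - C c) ^ 2 * sobolev α c M N n
          = polyA α c M N n * laguerre α n + polyB α c M N n * laguerre α (n - 1) ∧
      (X - C c) ^ 2 * sobolev α c M N n
          = laguerre α (n + 2) + C (bTilde α c M N n) * laguerre α (n + 1)
            + C (cTilde α c M N n) * laguerre α n
            + C (dTilde α c M N n) * laguerre α (n - 1)
            + C (eTilde α c M N n) * laguerre α (n - 2)) ∧
    Tendsto (fun n : ℕ => bTilde α c M N n / (4 * (n : ℝ))) atTop (𝓝 1) ∧
    Tendsto (fun n : ℕ => cTilde α c M N n / (6 * (n : ℝ) ^ 2)) atTop (𝓝 1) ∧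
    Tendsto (fun n : ℕ => dTilde α c M N n / (4 * (n : ℝ) ^ 3)) atTop (𝓝 1) ∧
    Tendsto (fun n : ℕ => eTilde α c M N n / (n : ℝ) ^ 4) atTop (𝓝 1) := by
  refine ⟨fun n hn => ⟨connection_formula hα c hM hN hn, connection_expansion hα c hM hN hn⟩, ?_⟩
  obtain ⟨hA1, hA0, hB1, hB0⟩ := tendsto_coeff hα hc hM hN
  have he : Tendsto (fun n : ℕ => (n : ℝ)⁻¹) atTop (𝓝 0) := tendsto_inv_atTop_nhds_zero_nat
  have hT := he.prodMk_nhds (hA1.prodMk_nhds (hA0.prodMk_nhds (hB1.prodMk_nhds hB0)))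
  -- Each normalized coefficient is a polynomial F in 1/n and the four normalized corrections, all
  -- of which tend to 0; the limit is then F(0) = 1 by continuity.
  have key : ∀ (F : ℝ × ℝ × ℝ × ℝ × ℝ → ℝ) (f : ℕ → ℝ), Continuous F → F (0, 0, 0, 0, 0) = 1 →
      (∀ n : ℕ, (n : ℝ) ≠ 0 → F ((n : ℝ)⁻¹, coeffA1 α c M N n / (n : ℝ),
        coeffA0 α c M N n / (n : ℝ) ^ 2, coeffB1 α c M N n / (n : ℝ) ^ 2,
        coeffB0 α c M N n / (n : ℝ) ^ 3) = f n) → Tendsto f atTop (𝓝 1) := by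
    intro F f hF h1 hf
    have h := (hF.tendsto (0, 0, 0, 0, 0)).comp hT
    rw [h1] at h
    refine h.congr' ?_
    filter_upwards [eventually_ge_atTop 1] with n hn
    exact hf n (by positivity)
  refine ⟨key (fun p => (4 + (2 * α + 4 - 2 * c) * p.1 + p.2.1) / 4) _ (by fun_prop) (by norm_num)
      fun n hn => ?_,
    key (fun p => ((1 + p.1) * (1 + p.1 + α * p.1) + (1 + α * p.1)
      + (2 + (α + 1 - c) * p.1) ^ 2 + p.2.1 * (2 + (α + 1 - c) * p.1) + p.2.2.1
      + p.2.2.2.1) / 6) _ (by fun_prop) (by norm_num) fun n hn => ?_,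
    key (fun p => ((1 + α * p.1) * (4 + (2 * α - 2 * c) * p.1) + (1 + α * p.1) * p.2.1
      + (2 + (α - 1 - c) * p.1) * p.2.2.2.1 + p.2.2.2.2) / 4) _ (by fun_prop) (by norm_num)
      fun n hn => ?_,
    key (fun p => (1 + α * p.1) * ((1 - p.1) * (1 - p.1 + α * p.1))
      + (1 - p.1) * (1 - p.1 + α * p.1) * p.2.2.2.1) _ (by fun_prop) (by norm_num)
      fun n hn => ?_⟩
  · simp only [bTilde, betaCoeff]
    push_cast
    field_simp
    ring
  · simp only [cTilde, betaCoeff, gammaCoeff]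
    push_cast
    field_simp
    ring
  · simp only [dTilde, betaCoeff, gammaCoeff]
    push_cast
    field_simp
    ring
  · simp only [eTilde, gammaCoeff]
    push_cast
    field_simp
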